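/- **Algebraic Mapping Theorem.** Let $i\colon\mathcal A\hookrightarrow\mathcal G$ be a pair of groupoids, i.e. a functor between small groupoids that is injective on objects and on morphisms; write $s,t$ for source and target. Assume that $\mathcal A$ is amenable: there is a family of bounded linear maps $m_e\colon\ell^\infty(t^{-1}(e),\mathbb R)\to\mathbb R$ ($e\in\operatorname{ob}\mathcal A$) with $\|m_e\|=1$, with $m_e(c)=c$ for every constant function $c$, and with $m_{t(g)}\bigl(h\mapsto\varphi(g^{-1}h)\bigr)=m_{s(g)}(\varphi)$ for all $g\in\mathcal A$ and all $\varphi\in\ell^\infty(t^{-1}(s(g)),\mathbb R)$. Let $V$ be a Banach $\mathcal G$-module, i.e. a family $(V_e)_{e\in\operatorname{ob}\mathcal G}$ of real Banach spaces with a functorial action of $\mathcal G$ by linear isometries $V_{s(g)}\to V_{t(g)}$, and let $V'=(V_e')_e$ be its dual with the action $(g\cdot f)(v)=f(g^{-1}v)$. For $n\in\mathbb N$ and $e\in\operatorname{ob}\mathcal G$ let $C_n(\mathcal G)_e$ be the real vector space with basis all tuples $(g_0,\dots,g_n)$ of morphisms with $t(g_0)=e$ and $s(g_k)=t(g_{k+1})$,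 with the $\ell^1$-norm, the action $g\cdot(g_0,\dots,g_n)=(gg_0,g_1,\dots,g_n)$ and the boundary $\partial(g_0,\dots,g_n)=\sum_{k=0}^{n-1}(-1)^k(g_0,\dots,g_kg_{k+1},\dots,g_n)+(-1)^n(g_0,\dots,g_{n-1})$. For a Banach $\mathcal G$-module $W$, let $C_b^n(\mathcal G;W)$ be the space of $\mathcal G$-equivariant families $(f_e\colon C_n(\mathcal G)_e\to W_e)_e$ of bounded linear maps with $\|f\|:=\sup_e\|f_e\|<\infty$, let $C_b^n(\mathcal G,\mathcal A;W)$ be the subspace of those $f$ with $f_{i(a)}|_{C_n(\mathcal A)_a}=0$ for all $a\in\operatorname{ob}\mathcal A$, and let $H_b^n(\mathcal G;W)$ and $H_b^n(\mathcal G,\mathcal A;W)$ be the cohomologies of these complexes, with the induced quotient seminorms. Then for every $n\ge 2$ the map $$H_b^n(\mathcal G,\mathcal A;V')\longrightarrow H_b^n(\mathcal G;V')$$ induced by the inclusion $C_b^*(\mathcal G,\mathcal A;V')\subset C_b^*(\mathcal G;V')$ is an isometric isomorphism, i.e. it is linear, bijective and preserves the seminorms. -/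

import Mathlib

open CategoryTheory
open scoped ENNReal

universe v u v' u' w w' z

noncomputable section

namespace BoundedCohomology



/-! ### Normed modules over groupoids -/

section Modules

/-- A normed (left) module over a groupoid `G`: a family of normed real vector spaces indexed by
the objects, on which the morphisms act by linear isometries, functorially.
In Mathlib's order of composition, the product `g · h` of the groupoid is `h ≫ g`. -/
structure NormedMod (G : Type u) [Groupoid.{v} G] where
  carrier : G → Type w
  [normedAddCommGroup : ∀ e, NormedAddCommGroup (carrier e)]
  [normedSpace : ∀ e, NormedSpace ℝ (carrier e)]
  act : ∀ {e f : G}, (e ⟶ f) → carrier e →ₗᵢ[ℝ] carrier f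
  act_id : ∀ (e : G) (x : carrier e), act (𝟙 e) x = x
  act_comp : ∀ {e f k : G} (h : e ⟶ f) (g : f ⟶ k) (x : carrier e),
    act (h ≫ g) x = act g (act h x)

attribute [instance] NormedMod.normedAddCommGroup NormedMod.normedSpace

instance {G : Type u} [Groupoid.{v} G] :
    CoeFun (NormedMod.{v, u, w} G) (fun _ => G → Type w) := ⟨NormedMod.carrier⟩

variable {G : Type u} [Groupoid.{v} G]

/-- A Banach module: all the spaces of the family are complete. -/
class NormedMod.IsBanach (V : NormedMod.{v, u, w} G) : Prop where
  complete : ∀ e, CompleteSpace (V e)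

/-- A functorial action of a groupoid by norm non-increasing linear maps is isometric. -/
abbrev NormedMod.ofNormLe (carrier : G → Type w) [∀ e, NormedAddCommGroup (carrier e)]
    [∀ e, NormedSpace ℝ (carrier e)]
    (act : ∀ {e f : G}, (e ⟶ f) → carrier e →ₗ[ℝ] carrier f)
    (norm_act_le : ∀ {e f : G} (g : e ⟶ f) (x : carrier e), ‖act g x‖ ≤ ‖x‖)
    (act_id : ∀ (e : G) (x : carrier e), act (𝟙 e) x = x)
    (act_comp : ∀ {e f k : G} (h : e ⟶ f) (g : f ⟶ k) (x : carrier e),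
      act (h ≫ g) x = act g (act h x)) : NormedMod.{v, u, w} G where
  carrier := carrier
  act {e f} g :=
    { act g with
      norm_map' := fun x => le_antisymm (norm_act_le g x) <| by
        have h := norm_act_le (Groupoid.inv g) (act g x)
        rwa [← act_comp, Groupoid.comp_inv, act_id] at h }
  act_id := act_id
  act_comp := act_comp

theorem NormedMod.act_act_inv (V : NormedMod.{v, u, w} G) {e f : G} (g : e ⟶ f) (x : V f) :
    V.act g (V.act (Groupoid.inv g) x) = x := by
  rw [← V.act_comp, Groupoid.inv_comp, V.act_id]

theorem NormedMod.act_inv_act (V : NormedMod.{v, u, w} G) {e f : G} (g : e ⟶ f) (x : V e) :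
    V.act (Groupoid.inv g) (V.act g x) = x := by
  rw [← V.act_comp, Groupoid.comp_inv, V.act_id]

variable (G) in
/-- The trivial module: `ℝ` at every object, with every morphism acting as the identity. -/
abbrev trivialMod : NormedMod.{v, u, 0} G where
  carrier _ := ℝ
  act _ := LinearIsometry.id
  act_id _ _ := rfl
  act_comp _ _ _ := rfl

/-- The module `B(V, W)` of bounded linear maps `V e → W e` with the operator norm and the
conjugation action `(g · φ)(x) = g · φ(g⁻¹ · x)`. -/
abbrev homMod (V : NormedMod.{v, u, w} G) (W : NormedMod.{v, u, w'} G) :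
    NormedMod.{v, u, max w w'} G :=
  NormedMod.ofNormLe (fun e => V e →L[ℝ] W e)
    (fun g =>
      { toFun := fun φ => (W.act g).toContinuousLinearMap ∘L φ ∘L
          (V.act (Groupoid.inv g)).toContinuousLinearMap
        map_add' := fun φ ψ => by ext x; simp
        map_smul' := fun r φ => by ext x; simp })
    (fun g φ => by
      refine ContinuousLinearMap.opNorm_le_bound _ (norm_nonneg _) fun x => ?_
      simpa using φ.le_opNorm (V.act (Groupoid.inv g) x))
    (fun e φ => by
      ext x
      change W.act (𝟙 e) (φ (V.act (Groupoid.inv (𝟙 e)) x)) = φ x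
      rw [W.act_id, ← V.act_id e (V.act (Groupoid.inv (𝟙 e)) x), V.act_act_inv])
    (fun h g φ => by
      ext x
      have : V.act (Groupoid.inv (h ≫ g)) x
          = V.act (Groupoid.inv h) (V.act (Groupoid.inv g) x) := by
        rw [← V.act_comp]; congr 1; simp [Groupoid.inv_eq_inv]
      change W.act (h ≫ g) (φ (V.act (Groupoid.inv (h ≫ g)) x)) =
        W.act g (W.act h (φ (V.act (Groupoid.inv h) (V.act (Groupoid.inv g) x))))
      rw [W.act_comp, this])

/-- The topological dual `V'` of a normed module, with `(g · φ)(x) = φ(g⁻¹ · x)`. -/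
abbrev dualMod (V : NormedMod.{v, u, w} G) : NormedMod.{v, u, w} G :=
  homMod V (trivialMod G)

/-- The invariants of a normed module: the uniformly bounded families `(x_e)` with
`g · x_{s(g)} = x_{t(g)}` for all `g`, normed by the supremum of the `‖x_e‖`
(which is the norm of `lp _ ∞`). -/
def invariants (V : NormedMod.{v, u, w} G) : Submodule ℝ (lp V.carrier ∞) where
  carrier := {x | ∀ (e f : G) (g : e ⟶ f), V.act g (x e) = x f}
  zero_mem' := fun e f g => by simp
  add_mem' := fun {x y} hx hy e f g => by simp [hx e f g, hy e f g]
  smul_mem' := fun r x hx e f g => by simp [hx e f g]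

end Modules

/-! ### Amenability -/

section Amenable

variable {G : Type u} [Groupoid.{v} G]

/-- The set of all morphisms ending in the object `e`. -/
abbrev EndingIn (e : G) : Type (max u v) := Σ f : G, (f ⟶ e)

/-- Left multiplication `h ↦ g · h` from the morphisms ending in `s(g)` to those ending in
`t(g)`. -/
def EndingIn.mul {e f : G} (g : e ⟶ f) (h : EndingIn e) : EndingIn f := ⟨h.1, h.2 ≫ g⟩

/-- The module `ℓ^∞(G, V)`: at `e`, the bounded functions from the set of morphisms ending in `e`
to `V e`, with the supremum norm and the action `(g · φ)(h) = g · φ(g⁻¹ · h)`. -/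
abbrev linftyMod (V : NormedMod.{v, u, w} G) : NormedMod.{v, u, max u v w} G :=
  NormedMod.ofNormLe (fun e => lp (fun _ : EndingIn e => V e) ∞)
    (fun {e f} g =>
      { toFun := fun φ => ⟨fun h => V.act g (φ (EndingIn.mul (Groupoid.inv g) h)), by
          refine memℓp_infty ⟨‖φ‖, ?_⟩
          rintro _ ⟨h, rfl⟩
          simpa using lp.norm_apply_le_norm ENNReal.top_ne_zero φ _⟩
        map_add' := fun φ ψ => lp.ext (funext fun h => map_add (V.act g) _ _)
        map_smul' := fun r φ => lp.ext (funext fun h => map_smul (V.act g) r _) })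
    (fun g φ => lp.norm_le_of_forall_le (norm_nonneg _) fun h => by
      simpa using lp.norm_apply_le_norm ENNReal.top_ne_zero φ _)
    (fun e φ => by
      ext h
      simp [V.act_id, EndingIn.mul, Groupoid.inv_eq_inv])
    (fun h g φ => by
      ext k
      simp [V.act_comp, EndingIn.mul, Groupoid.inv_eq_inv])

/-- The constant function with value `x`, as an element of `ℓ^∞(G, V)`. -/
def constFun (V : NormedMod.{v, u, w} G) (e : G) (x : V e) : linftyMod V e :=
  (⟨fun _ => x, memℓp_infty ⟨‖x‖, by rintro _ ⟨_, rfl⟩; exact le_rfl⟩⟩ :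
    lp (fun _ : EndingIn e => V e) ∞)

variable (G) in
/-- A (left-)invariant mean on `G`: a `G`-map `ℓ^∞(G, ℝ) → ℝ` of norm one which sends constant
functions to their values. (The norm of a family is the supremum of the norms of its components;
here every component has norm at least one by `mean_const`, so that norm one means that each
component has norm one. The empty groupoid is amenable.) -/
structure InvariantMean where
  mean : ∀ e : G, linftyMod (trivialMod G) e →L[ℝ] trivialMod G e
  equivariant : ∀ {e f : G} (g : e ⟶ f) (φ : linftyMod (trivialMod G) e),
    mean f ((linftyMod (trivialMod G)).act g φ) = (trivialMod G).act g (mean e φ)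
  norm_mean : ∀ e, ‖mean e‖ = 1
  mean_const : ∀ (e : G) (x : trivialMod G e), mean e (constFun (trivialMod G) e x) = x

variable (G) in
/-- A groupoid is amenable if there is an invariant mean on it. -/
def IsAmenable : Prop := Nonempty (InvariantMean G)

end Amenable

/-! ### Free modules with the `ℓ¹`-norm -/

section FreeL1

/-- The real vector space with basis `P`, endowed with the `ℓ¹`-norm with respect to `P`. -/
def FreeL1 (P : Type w) : Type w := P →₀ ℝ

variable {P : Type w} {Q : Type w'} {R : Type z}

instance : AddCommGroup (FreeL1 P) := inferInstanceAs (AddCommGroup (P →₀ ℝ))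

instance : Module ℝ (FreeL1 P) := inferInstanceAs (Module ℝ (P →₀ ℝ))

/-- The basis element of `p`. -/
def FreeL1.of (p : P) : FreeL1 P := Finsupp.single p 1

instance : Norm (FreeL1 P) := ⟨fun x => Finsupp.sum (M := ℝ) x fun _ r => |r|⟩

theorem FreeL1.norm_eq_sum (x : FreeL1 P) (s : Finset P)
    (hs : Finsupp.support (M := ℝ) x ⊆ s) : ‖x‖ = ∑ p ∈ s, |(show P →₀ ℝ from x) p| :=
  Finsupp.sum_of_support_subset (M := ℝ) x hs _ (by simp)

theorem FreeL1.normedSpaceCore : NormedSpace.Core ℝ (FreeL1 P) where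
  norm_nonneg x := Finset.sum_nonneg fun _ _ => abs_nonneg _
  norm_smul r x := by
    classical
    rw [FreeL1.norm_eq_sum (r • x) _ (Finsupp.support_smul (M := ℝ)),
      FreeL1.norm_eq_sum x _ (Finset.Subset.refl _), Finset.mul_sum]
    exact Finset.sum_congr rfl fun p _ => abs_mul r _
  norm_triangle x y := by
    classical
    rw [FreeL1.norm_eq_sum (x + y) _ (Finsupp.support_add (M := ℝ)),
      FreeL1.norm_eq_sum x _ Finset.subset_union_left,
      FreeL1.norm_eq_sum y _ Finset.subset_union_right, ← Finset.sum_add_distrib]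
    exact Finset.sum_le_sum fun p _ => abs_add_le _ _
  norm_eq_zero_iff x := by
    constructor
    · intro h
      have h' := (Finset.sum_eq_zero_iff_of_nonneg fun _ _ => abs_nonneg _).1 h
      refine Finsupp.ext (M := ℝ) fun p => ?_
      by_contra hp
      exact hp (abs_eq_zero.1 (h' p (Finsupp.mem_support_iff.2 hp)))
    · rintro rfl
      exact Finsupp.sum_zero_index

instance : NormedAddCommGroup (FreeL1 P) := NormedAddCommGroup.ofCore FreeL1.normedSpaceCore

instance : NormedSpace ℝ (FreeL1 P) := NormedSpace.ofCore FreeL1.normedSpaceCore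

@[ext] theorem FreeL1.hom_ext {E : Type w'} [AddCommGroup E] [Module ℝ E]
    {φ ψ : FreeL1 P →ₗ[ℝ] E} (h : ∀ p, φ (FreeL1.of p) = ψ (FreeL1.of p)) : φ = ψ :=
  Finsupp.lhom_ext' (M := ℝ) fun p => LinearMap.ext_ring (h p)

/-- The linear map sending basis elements to basis elements as prescribed by `f`. -/
def FreeL1.mapₗ (f : P → Q) : FreeL1 P →ₗ[ℝ] FreeL1 Q := Finsupp.lmapDomain ℝ ℝ f

@[simp] theorem FreeL1.mapₗ_of (f : P → Q) (p : P) :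
    FreeL1.mapₗ f (FreeL1.of p) = FreeL1.of (f p) :=
  Finsupp.mapDomain_single

theorem FreeL1.norm_mapₗ_le (f : P → Q) (x : FreeL1 P) : ‖FreeL1.mapₗ f x‖ ≤ ‖x‖ := by
  have hx : FreeL1.mapₗ f x = Finset.sum (Finsupp.support (M := ℝ) x)
      fun p => (show P →₀ ℝ from x) p • FreeL1.of (f p) := by
    conv_lhs => rw [show x = Finset.sum (Finsupp.support (M := ℝ) x)
      fun p => (show P →₀ ℝ from x) p • FreeL1.of p from
        (Finsupp.sum_single (M := ℝ) x).symm.trans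
          (Finset.sum_congr rfl fun p _ => (Finsupp.smul_single_one p _).symm)]
    simp
  rw [hx]
  refine (norm_sum_le _ _).trans (Finset.sum_le_sum fun p _ => ?_)
  rw [norm_smul, Real.norm_eq_abs]
  refine (mul_le_of_le_one_right (abs_nonneg _) (le_of_eq ?_))
  exact (Finsupp.sum_single_index (by simp)).trans abs_one

/-- The bounded linear map sending basis elements to basis elements as prescribed by `f`. -/
def FreeL1.map (f : P → Q) : FreeL1 P →L[ℝ] FreeL1 Q :=
  (FreeL1.mapₗ f).mkContinuous 1 fun x => by simpa using FreeL1.norm_mapₗ_le f x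

@[simp] theorem FreeL1.map_of (f : P → Q) (p : P) :
    FreeL1.map f (FreeL1.of p) = FreeL1.of (f p) := FreeL1.mapₗ_of f p

theorem FreeL1.norm_map_apply_le (f : P → Q) (x : FreeL1 P) : ‖FreeL1.map f x‖ ≤ ‖x‖ :=
  FreeL1.norm_mapₗ_le f x

theorem FreeL1.hom_ext_apply {E : Type w'} [AddCommGroup E] [Module ℝ E] [TopologicalSpace E]
    {φ ψ : FreeL1 P →L[ℝ] E} (h : ∀ p, φ (FreeL1.of p) = ψ (FreeL1.of p)) : φ = ψ :=
  ContinuousLinearMap.coe_injective (FreeL1.hom_ext h)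

end FreeL1

/-! ### The bar resolution -/

section Bar

variable {G : Type u} [Groupoid.{v} G]

/-- `BarPath n e` is the set of `(n+1)`-paths `(g₀, …, gₙ)` ending in `e`:
`t(g₀) = e` and `s(gᵢ) = t(gᵢ₊₁)`. -/
inductive BarPath {G : Type u} [Groupoid.{v} G] : ℕ → G → Type (max u v)
  | single {e f : G} (g : f ⟶ e) : BarPath 0 e
  | cons {n : ℕ} {e f : G} (g : f ⟶ e) (p : BarPath n f) : BarPath (n + 1) e

/-- `g · (g₀, …, gₙ) = (g · g₀, g₁, …, gₙ)`. -/
def BarPath.mul : ∀ {n : ℕ} {e f : G}, (e ⟶ f) → BarPath n e → BarPath n f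
  | _, _, _, g, .single h => .single (h ≫ g)
  | _, _, _, g, .cons h p => .cons (h ≫ g) p

/-- The faces of `(g₀, …, gₙ₊₁)`: the `i`-th face is `(g₀, …, gᵢ · gᵢ₊₁, …, gₙ₊₁)` for `i ≤ n`,
and `(g₀, …, gₙ)` for `i = n + 1`. -/
def BarPath.face : ∀ {n : ℕ} {e : G}, Fin (n + 2) → BarPath (n + 1) e → BarPath n e
  | 0, _, i, .cons g p => Fin.cases (p.mul g) (fun _ => .single g) i
  | _ + 1, _, i, .cons g p => Fin.cases (p.mul g) (fun j => .cons g (p.face j)) i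

/-- The path `(f(g₀), …, f(gₙ))` for a groupoid map `f`. -/
def BarPath.map {A : Type u'} [Groupoid.{v'} A] (F : A ⥤ G) :
    ∀ {n : ℕ} {e : A}, BarPath n e → BarPath n (F.obj e)
  | _, _, .single g => .single (F.map g)
  | _, _, .cons g p => .cons (F.map g) (p.map F)

@[simp] theorem BarPath.mul_single {e f k : G} (g : e ⟶ f) (h : k ⟶ e) :
    (BarPath.single h).mul g = .single (h ≫ g) := rfl

@[simp] theorem BarPath.mul_cons {n : ℕ} {e f k : G} (g : e ⟶ f) (h : k ⟶ e)
    (p : BarPath n k) : (BarPath.cons h p).mul g = .cons (h ≫ g) p := rfl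

@[simp] theorem BarPath.face_zero_cons {n : ℕ} {e f : G} (g : f ⟶ e) (p : BarPath n f) :
    (BarPath.cons g p).face 0 = p.mul g := by
  cases n <;> rfl

@[simp] theorem BarPath.face_succ_cons_zero {e f : G} (g : f ⟶ e) (p : BarPath 0 f)
    (j : Fin 1) : (BarPath.cons g p).face j.succ = .single g := rfl

@[simp] theorem BarPath.face_succ_cons {n : ℕ} {e f : G} (g : f ⟶ e) (p : BarPath (n + 1) f)
    (j : Fin (n + 2)) : (BarPath.cons g p).face j.succ = .cons g (p.face j) := rfl

theorem BarPath.mul_id {n : ℕ} {e : G} (p : BarPath n e) : p.mul (𝟙 e) = p := by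
  cases p <;> simp

theorem BarPath.mul_comp {n : ℕ} {e f k : G} (h : e ⟶ f) (g : f ⟶ k) (p : BarPath n e) :
    p.mul (h ≫ g) = (p.mul h).mul g := by
  cases p <;> simp

theorem BarPath.face_mul {n : ℕ} {e f : G} (g : e ⟶ f) (i : Fin (n + 2))
    (p : BarPath (n + 1) e) : (p.mul g).face i = (p.face i).mul g := by
  cases p with
  | cons h p =>
    cases n <;> refine Fin.cases ?_ (fun j => ?_) i <;>
      simp [BarPath.mul_comp]

theorem BarPath.map_mul {A : Type u'} [Groupoid.{v'} A] (F : A ⥤ G) {n : ℕ} {e f : A}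
    (g : e ⟶ f) (p : BarPath n e) : (p.mul g).map F = (p.map F).mul (F.map g) := by
  cases p <;> simp [BarPath.mul, BarPath.map]

theorem BarPath.map_face {A : Type u'} [Groupoid.{v'} A] (F : A ⥤ G) :
    ∀ {n : ℕ} {e : A} (i : Fin (n + 2)) (p : BarPath (n + 1) e),
      (p.face i).map F = (p.map F).face i
  | 0, _, i, .cons g p => by
    refine Fin.cases ?_ (fun j => ?_) i
    · simp [BarPath.map, BarPath.map_mul]
    · simp [BarPath.map]
  | n + 1, _, i, .cons g p => by
    refine Fin.cases ?_ (fun j => ?_) i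
    · simp [BarPath.map, BarPath.map_mul]
    · simp [BarPath.map, BarPath.map_face F j p]

variable (G) in
/-- The `n`-th module `C_n(G)` of the bar resolution: at `e`, the vector space with basis the
`(n+1)`-paths ending in `e`, with the `ℓ¹`-norm. -/
abbrev barMod (n : ℕ) : NormedMod.{v, u, max u v} G :=
  NormedMod.ofNormLe (fun e => FreeL1 (BarPath n e))
    (fun g => FreeL1.mapₗ (BarPath.mul g))
    (fun g x => FreeL1.norm_mapₗ_le _ x)
    (fun e x => by
      have : FreeL1.mapₗ (BarPath.mul (n := n) (𝟙 e)) = LinearMap.id :=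
        FreeL1.hom_ext fun p => by simp [BarPath.mul_id]
      rw [this]; rfl)
    (fun h g x => by
      have : FreeL1.mapₗ (BarPath.mul (n := n) (h ≫ g)) =
          FreeL1.mapₗ (BarPath.mul g) ∘ₗ FreeL1.mapₗ (BarPath.mul h) :=
        FreeL1.hom_ext fun p => by simp [BarPath.mul_comp]
      rw [this]; rfl)

/-- The boundary map `∂ : C_{n+1}(G) → C_n(G)`, the alternating sum of the faces. -/
def barBoundary (n : ℕ) (e : G) : barMod G (n + 1) e →L[ℝ] barMod G n e :=
  (∑ i : Fin (n + 2), (-1 : ℝ) ^ (i : ℕ) • FreeL1.map (BarPath.face i) :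
    FreeL1 (BarPath (n + 1) e) →L[ℝ] FreeL1 (BarPath n e))

/-- The map `C_n(F) : C_n(A) → F^* C_n(G)` induced by a groupoid map. -/
def barMap {A : Type u'} [Groupoid.{v'} A] (F : A ⥤ G) (n : ℕ) (a : A) :
    barMod A n a →L[ℝ] barMod G n (F.obj a) :=
  (FreeL1.map (BarPath.map F) : FreeL1 (BarPath n a) →L[ℝ] FreeL1 (BarPath n (F.obj a)))

theorem barBoundary_of (n : ℕ) (e : G) (p : BarPath (n + 1) e) :
    barBoundary n e (FreeL1.of p) =
      ∑ i : Fin (n + 2), (-1 : ℝ) ^ (i : ℕ) • FreeL1.of (p.face i) := by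
  simp [barBoundary]

theorem norm_barBoundary_le (n : ℕ) (e : G) : ‖barBoundary n e‖ ≤ n + 2 := by
  refine (norm_sum_le _ _).trans ?_
  calc _ ≤ ∑ _i : Fin (n + 2), (1 : ℝ) := Finset.sum_le_sum fun i _ => by
        rw [norm_smul]
        simpa using ContinuousLinearMap.opNorm_le_bound _ zero_le_one fun x => by
          simpa using FreeL1.norm_map_apply_le (BarPath.face (e := e) i) x
    _ = n + 2 := by simp

theorem barMod_act_of {n : ℕ} {e f : G} (g : e ⟶ f) (p : BarPath n e) :
    (barMod G n).act g (FreeL1.of p) = FreeL1.of (p.mul g) :=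
  FreeL1.mapₗ_of _ p

theorem barMap_of {A : Type u'} [Groupoid.{v'} A] (F : A ⥤ G) {n : ℕ} {a : A}
    (p : BarPath n a) : barMap F n a (FreeL1.of p) = FreeL1.of (p.map F) :=
  FreeL1.map_of _ p

theorem barBoundary_act (n : ℕ) {e f : G} (g : e ⟶ f) (x : barMod G (n + 1) e) :
    barBoundary n f ((barMod G (n + 1)).act g x) = (barMod G n).act g (barBoundary n e x) := by
  have : barBoundary n f ∘L ((barMod G (n + 1)).act g).toContinuousLinearMap =
      ((barMod G n).act g).toContinuousLinearMap ∘L barBoundary n e := by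
    refine FreeL1.hom_ext_apply fun p => ?_
    change barBoundary n f ((barMod G (n + 1)).act g (FreeL1.of p)) =
      (barMod G n).act g (barBoundary n e (FreeL1.of p))
    rw [barMod_act_of, barBoundary_of, barBoundary_of, map_sum]
    refine Finset.sum_congr rfl fun i _ => ?_
    rw [map_smul, barMod_act_of, BarPath.face_mul]
  exact DFunLike.congr_fun this x

theorem barBoundary_barMap {A : Type u'} [Groupoid.{v'} A] (F : A ⥤ G) (n : ℕ) (a : A)
    (x : barMod A (n + 1) a) :
    barBoundary n (F.obj a) (barMap F (n + 1) a x) = barMap F n a (barBoundary n a x) := by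
  have : barBoundary n (F.obj a) ∘L barMap F (n + 1) a = barMap F n a ∘L barBoundary n a := by
    refine FreeL1.hom_ext_apply fun p => ?_
    change barBoundary n (F.obj a) (barMap F (n + 1) a (FreeL1.of p)) =
      barMap F n a (barBoundary n a (FreeL1.of p))
    rw [barMap_of, barBoundary_of, barBoundary_of, map_sum]
    refine Finset.sum_congr rfl fun i _ => ?_
    rw [map_smul, barMap_of, BarPath.map_face]
  exact DFunLike.congr_fun this x

/-- The linear map `(g₁, …, gₙ₊₁) ↦ (g, g₁, …, gₙ₊₁)`. -/
def barCons (n : ℕ) {e f : G} (g : f ⟶ e) : barMod G n f →L[ℝ] barMod G (n + 1) e :=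
  (FreeL1.map (BarPath.cons g) : FreeL1 (BarPath n f) →L[ℝ] FreeL1 (BarPath (n + 1) e))

theorem barCons_of {n : ℕ} {e f : G} (g : f ⟶ e) (p : BarPath n f) :
    barCons n g (FreeL1.of p) = FreeL1.of (BarPath.cons g p) :=
  FreeL1.map_of _ p

theorem barBoundary_barCons (n : ℕ) {e f : G} (g : f ⟶ e) (x : barMod G (n + 1) f) :
    barBoundary (n + 1) e (barCons (n + 1) g x) =
      (barMod G (n + 1)).act g x - barCons n g (barBoundary n f x) := by
  have : barBoundary (n + 1) e ∘L barCons (n + 1) g =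
      ((barMod G (n + 1)).act g).toContinuousLinearMap - barCons n g ∘L barBoundary n f := by
    refine FreeL1.hom_ext_apply fun p => ?_
    change barBoundary (n + 1) e (barCons (n + 1) g (FreeL1.of p)) =
      (barMod G (n + 1)).act g (FreeL1.of p) - barCons n g (barBoundary n f (FreeL1.of p))
    rw [barCons_of, barBoundary_of, barBoundary_of, barMod_act_of, map_sum, Fin.sum_univ_succ,
      sub_eq_add_neg, ← Finset.sum_neg_distrib]
    congr 1
    · simp
    · refine Finset.sum_congr rfl fun i _ => ?_
      rw [map_smul, barCons_of, Fin.val_succ, pow_succ, mul_neg_one, neg_smul]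
      rfl
  exact DFunLike.congr_fun this x

theorem barBoundary_barBoundary : ∀ (n : ℕ) (e : G) (x : barMod G (n + 2) e),
    barBoundary n e (barBoundary (n + 1) e x) = 0 := by
  intro n
  induction n with
  | zero =>
    intro e x
    have : barBoundary 0 e ∘L barBoundary 1 e = 0 := by
      refine FreeL1.hom_ext_apply fun p => ?_
      change barBoundary 0 e (barBoundary 1 e (FreeL1.of p)) = 0
      have key : ∀ {a b c : G} (g : b ⟶ a) (h : c ⟶ b),
          barBoundary 0 a (FreeL1.of (BarPath.cons g (BarPath.single h))) =
            FreeL1.of (BarPath.single (h ≫ g)) - FreeL1.of (BarPath.single g) := by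
        intro a b c g h
        rw [barBoundary_of, Fin.sum_univ_succ, Fin.sum_univ_one, BarPath.face_zero_cons,
          BarPath.face_succ_cons_zero]
        simp [sub_eq_add_neg]
      rcases p with _ | ⟨g, q⟩
      rcases q with _ | ⟨h, q⟩
      rcases q with k | _
      rw [← barCons_of, barBoundary_barCons, barMod_act_of, key, map_sub, map_sub, barCons_of,
        barCons_of, map_sub, BarPath.mul_cons, key, key, key]
      simp
    exact DFunLike.congr_fun this x
  | succ n ih =>
    intro e x
    have : barBoundary (n + 1) e ∘L barBoundary (n + 2) e = 0 := by
      refine FreeL1.hom_ext_apply fun p => ?_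
      change barBoundary (n + 1) e (barBoundary (n + 2) e (FreeL1.of p)) = 0
      cases p with
      | cons g p =>
        rw [← barCons_of, barBoundary_barCons, map_sub, barBoundary_barCons, barBoundary_act, ih]
        simp
    exact DFunLike.congr_fun this x

end Bar

/-! ### Normed cochain complexes and their cohomology -/

section Complexes

/-- A normed real cochain complex (in degrees `n ≥ 0`). -/
structure NormedCochainComplex where
  X : ℕ → Type w
  [normedAddCommGroup : ∀ n, NormedAddCommGroup (X n)]
  [normedSpace : ∀ n, NormedSpace ℝ (X n)]
  d : ∀ n, X n →L[ℝ] X (n + 1)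
  d_comp_d : ∀ n (x : X n), d (n + 1) (d n x) = 0

attribute [instance] NormedCochainComplex.normedAddCommGroup NormedCochainComplex.normedSpace

namespace NormedCochainComplex

/-- The `n`-cocycles. -/
def cocycles (C : NormedCochainComplex.{w}) (n : ℕ) : Submodule ℝ (C.X n) :=
  LinearMap.ker (C.d n).toLinearMap

/-- The `n`-coboundaries. -/
def coboundaries (C : NormedCochainComplex.{w}) : ∀ n : ℕ, Submodule ℝ (C.X n)
  | 0 => ⊥
  | n + 1 => LinearMap.range (C.d n).toLinearMap

/-- The cohomology (cocycles modulo coboundaries). As a quotient of a normed space it carries the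
induced seminorm: the infimum of the norms of the representing cocycles. -/
abbrev Cohomology (C : NormedCochainComplex.{w}) (n : ℕ) : Type w :=
  C.cocycles n ⧸ (C.coboundaries n).submoduleOf (C.cocycles n)

/-- A bounded cochain map. -/
structure Hom (C : NormedCochainComplex.{w}) (D : NormedCochainComplex.{w'}) where
  f : ∀ n, C.X n →L[ℝ] D.X n
  comm : ∀ n (x : C.X n), D.d n (f n x) = f (n + 1) (C.d n x)

variable {C : NormedCochainComplex.{w}} {D : NormedCochainComplex.{w'}}

theorem Hom.map_cocycles (φ : Hom C D) (n : ℕ) (x : C.X n) (hx : x ∈ C.cocycles n) :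
    φ.f n x ∈ D.cocycles n := by
  have hx' : C.d n x = 0 := hx
  change D.d n (φ.f n x) = 0
  rw [φ.comm, hx', map_zero]

theorem Hom.map_coboundaries (φ : Hom C D) : ∀ (n : ℕ) (x : C.X n), x ∈ C.coboundaries n →
    φ.f n x ∈ D.coboundaries n
  | 0, x, hx => by
    have hx' : x = 0 := hx
    rw [hx', map_zero]
    exact Submodule.zero_mem _
  | n + 1, x, hx => by
    obtain ⟨y, rfl⟩ := hx
    exact ⟨φ.f n y, φ.comm n y⟩

/-- The map `H^n(φ)` induced on cohomology by a cochain map `φ`. -/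
def Hom.cohomologyMap (φ : Hom C D) (n : ℕ) : C.Cohomology n →ₗ[ℝ] D.Cohomology n :=
  Submodule.mapQ _ _ ((φ.f n).toLinearMap.restrict (φ.map_cocycles n))
    fun x hx => φ.map_coboundaries n x.1 hx

/-- A subcomplex, with the induced norms. -/
def sub (C : NormedCochainComplex.{w}) (S : ∀ n, Submodule ℝ (C.X n))
    (hS : ∀ n, ∀ x ∈ S n, C.d n x ∈ S (n + 1)) : NormedCochainComplex.{w} where
  X n := S n
  d n := ((C.d n).comp (S n).subtypeL).codRestrict (S (n + 1)) fun x => hS n x.1 x.2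
  d_comp_d n x := Subtype.ext (C.d_comp_d n x.1)

/-- The inclusion of a subcomplex. -/
def subInclusion (C : NormedCochainComplex.{w}) (S : ∀ n, Submodule ℝ (C.X n))
    (hS : ∀ n, ∀ x ∈ S n, C.d n x ∈ S (n + 1)) : Hom (C.sub S hS) C where
  f n := (S n).subtypeL
  comm _ _ := rfl

end NormedCochainComplex

end Complexes

/-! ### Bounded cohomology of groupoids and of pairs of groupoids -/

section Cohomology

variable {G : Type u} [Groupoid.{v} G]

/-- `C_b^n(G; V) = B_G(C_n(G), V)`, the invariants of `B(C_n(G), V)`. -/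
abbrev BddCochain (V : NormedMod.{v, u, w} G) (n : ℕ) : Type (max u v w) :=
  invariants (homMod (barMod G n) V)

/-- The component of a cochain at an object `e`. -/
def BddCochain.at {V : NormedMod.{v, u, w} G} {n : ℕ} (φ : BddCochain V n) (e : G) :
    barMod G n e →L[ℝ] V e := φ.1 e

theorem BddCochain.equivariant {V : NormedMod.{v, u, w} G} {n : ℕ} (φ : BddCochain V n)
    {e f : G} (g : e ⟶ f) (x : barMod G n e) :
    φ.at f ((barMod G n).act g x) = V.act g (φ.at e x) := by
  have h : (homMod (barMod G n) V).act g (φ.1 e) = φ.1 f := φ.2 e f g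
  have h' : V.act g (φ.at e ((barMod G n).act (Groupoid.inv g) ((barMod G n).act g x))) =
      φ.at f ((barMod G n).act g x) :=
    DFunLike.congr_fun (show (_ : barMod G n f →L[ℝ] V f) = _ from h) ((barMod G n).act g x)
  rw [← h', NormedMod.act_inv_act]

theorem BddCochain.norm_at_le {V : NormedMod.{v, u, w} G} {n : ℕ} (φ : BddCochain V n) (e : G) :
    ‖φ.at e‖ ≤ ‖φ‖ :=
  lp.norm_apply_le_norm ENNReal.top_ne_zero φ.1 e

theorem norm_comp_barBoundary_le {V : NormedMod.{v, u, w} G} {n : ℕ} (φ : BddCochain V n)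
    (e : G) : ‖φ.at e ∘L barBoundary n e‖ ≤ (n + 2) * ‖φ‖ := by
  refine (ContinuousLinearMap.opNorm_comp_le _ _).trans ?_
  rw [mul_comm]
  exact mul_le_mul (norm_barBoundary_le n e) (φ.norm_at_le e) (norm_nonneg _) (by positivity)

/-- The differential `(φ_e) ↦ (φ_e ∘ ∂)` of the complex of bounded cochains. -/
def bddDifferentialₗ (V : NormedMod.{v, u, w} G) (n : ℕ) :
    BddCochain V n →ₗ[ℝ] BddCochain V (n + 1) where
  toFun φ := ⟨⟨fun e => φ.at e ∘L barBoundary n e, by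
      refine memℓp_infty ⟨(n + 2) * ‖φ‖, ?_⟩
      rintro _ ⟨e, rfl⟩
      exact norm_comp_barBoundary_le φ e⟩, by
      intro e f g
      refine ContinuousLinearMap.ext fun x => ?_
      change V.act g (φ.at e (barBoundary n e ((barMod G (n + 1)).act (Groupoid.inv g) x))) =
        φ.at f (barBoundary n f x)
      rw [← φ.equivariant, ← barBoundary_act, NormedMod.act_act_inv]⟩
  map_add' φ ψ := rfl
  map_smul' r φ := rfl

/-- The Banach bar complex `C_b^*(G; V)` with coefficients in `V`. -/
def bddComplex (V : NormedMod.{v, u, w} G) : NormedCochainComplex.{max u v w} where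
  X n := BddCochain V n
  d n := (bddDifferentialₗ V n).mkContinuous (n + 2) fun φ =>
    lp.norm_le_of_forall_le (by positivity) fun e => norm_comp_barBoundary_le φ e
  d_comp_d n φ := by
    refine Subtype.ext (lp.ext (funext fun e => ContinuousLinearMap.ext fun x => ?_))
    change φ.at e (barBoundary n e (barBoundary (n + 1) e x)) = 0
    rw [barBoundary_barBoundary, map_zero]

/-- Bounded cohomology `H_b^n(G; V)`, with its seminorm. -/
abbrev Hb (V : NormedMod.{v, u, w} G) (n : ℕ) : Type (max u v w) :=
  (bddComplex V).Cohomology n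

variable {A : Type u'} [Groupoid.{v'} A]

/-- A pair of groupoids: a groupoid map which is injective on objects and on morphisms. -/
structure IsPair (i : A ⥤ G) : Prop where
  obj_injective : Function.Injective i.obj
  map_injective : ∀ a b : A, Function.Injective (fun g : a ⟶ b => i.map g)

/-- The relative cochains `C_b^n(G, A; V)`: those bounded cochains which vanish on `C_n(A)`. -/
def relCochain (i : A ⥤ G) (V : NormedMod.{v, u, w} G) (n : ℕ) :
    Submodule ℝ ((bddComplex V).X n) where
  carrier := {φ : BddCochain V n | ∀ a : A, φ.at (i.obj a) ∘L barMap i n a = 0}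
  zero_mem' := fun a => rfl
  add_mem' := fun {φ ψ} hφ hψ a => ContinuousLinearMap.ext fun x => by
    have h₁ : BddCochain.at φ (i.obj a) (barMap i n a x) = 0 := DFunLike.congr_fun (hφ a) x
    have h₂ : BddCochain.at ψ (i.obj a) (barMap i n a x) = 0 := DFunLike.congr_fun (hψ a) x
    change BddCochain.at φ (i.obj a) (barMap i n a x) +
      BddCochain.at ψ (i.obj a) (barMap i n a x) = 0
    rw [h₁, h₂, add_zero]
  smul_mem' := fun r φ hφ a => ContinuousLinearMap.ext fun x => by
    have h : BddCochain.at φ (i.obj a) (barMap i n a x) = 0 := DFunLike.congr_fun (hφ a) x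
    change r • BddCochain.at φ (i.obj a) (barMap i n a x) = 0
    rw [h, smul_zero]

theorem relCochain_d (i : A ⥤ G) (V : NormedMod.{v, u, w} G) (n : ℕ)
    (φ : (bddComplex V).X n) (hφ : φ ∈ relCochain i V n) :
    (bddComplex V).d n φ ∈ relCochain i V (n + 1) := fun a =>
  ContinuousLinearMap.ext fun x => by
    change BddCochain.at φ (i.obj a) (barBoundary n (i.obj a) (barMap i (n + 1) a x)) = 0
    rw [barBoundary_barMap]
    exact DFunLike.congr_fun (hφ a) (barBoundary n a x)

/-- The relative complex `C_b^*(G, A; V)`, with the norm induced from `C_b^*(G; V)`. -/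
def relComplex (i : A ⥤ G) (V : NormedMod.{v, u, w} G) : NormedCochainComplex.{max u v w} :=
  (bddComplex V).sub (relCochain i V) (relCochain_d i V)

/-- Relative bounded cohomology `H_b^n(G, A; V)`, with its seminorm. -/
abbrev HbRel (i : A ⥤ G) (V : NormedMod.{v, u, w} G) (n : ℕ) : Type (max u v w) :=
  (relComplex i V).Cohomology n

/-- The canonical map `H_b^n(G, A; V) → H_b^n(G; V)`, induced by the inclusion
`C_b^*(G, A; V) → C_b^*(G; V)`. -/
def HbRel.toHb (i : A ⥤ G) (V : NormedMod.{v, u, w} G) (n : ℕ) :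
    HbRel i V n →ₗ[ℝ] Hb V n :=
  ((bddComplex V).subInclusion (relCochain i V) (relCochain_d i V)).cohomologyMap n

end Cohomology

end BoundedCohomology

end

/-! Replace a path `(g₀, …, gₙ)` by its homogeneous tuple `(g₀, g₀g₁, …, g₀⋯gₙ)` of morphisms with a
common target. A cochain with values in `V'` becomes, for each vector `y` of `V e`, a bounded real
function on such tuples, depending linearly on `y`; the boundary becomes deletion of entries and the
action becomes left multiplication of all entries. Operators on real functions that commute with
left multiplication therefore act on cochains, and duality reduces all averaging to real-valued
means.

The invariant mean on `A` is pushed forward to `G` at the objects of `A`, and completed by point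
masses at the other objects. Translating along a morphism `x` gives a mean `translate x` on the
morphisms with the same target as `x`. By invariance, all morphisms of `A` with target `a` yield the
same translated mean on bounded functions.

Surjectivity and the norm: average a cocycle in every entry with respect to the translated means,
then alternate. Both operations are norm non-increasing cochain maps and commute with left
multiplication. On tuples of `A` the average is constant, and alternation kills constants as soon as
there are two entries (`altAverage_map`). An equivariant bounded cone homotopy (`δ_homotopy`) shows
that the class is unchanged. Thus every class of positive degree has relative representatives of no
larger norm than any given one (`exists_mem_relCochain_of_d_eq_zero`).

Injectivity: if `dφ` is relative, averaging over an additional first entry in `A` produces `χ` with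
`dχ = φ` on `A`, so `φ - dχ` is relative with the same coboundary
(`exists_mem_relCochain_of_d_mem`). Here `φ` must have positive degree for `χ` to exist, so the
class of `dφ` has degree at least two. -/

noncomputable section

/-! ### Cochains on tuples of elements of a set -/

/-- Real-valued functions on the `n`-tuples of elements of `X`. -/
abbrev TupleCochain (X : Type u) (n : ℕ) : Type u := (Fin n → X) → ℝ

namespace TupleCochain

variable {X : Type u} {Y : Type u'}

/-- Fixing the first entry of the tuples. -/
def slice {n : ℕ} (y : X) : TupleCochain X (n + 1) →ₗ[ℝ] TupleCochain X n where
  toFun f x := f (Fin.cons y x)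
  map_add' _ _ := rfl
  map_smul' _ _ := rfl

/-- The augmented simplicial coboundary. -/
def δ (n : ℕ) : TupleCochain X n →ₗ[ℝ] TupleCochain X (n + 1) where
  toFun f x := ∑ i : Fin (n + 1), (-1 : ℝ) ^ (i : ℕ) * f (i.removeNth x)
  map_add' f g := by
    funext x
    simp [mul_add, Finset.sum_add_distrib]
  map_smul' r f := by
    funext x
    simp [Finset.mul_sum, mul_left_comm]

theorem slice_apply {n : ℕ} (y : X) (f : TupleCochain X (n + 1)) (x : Fin n → X) :
    slice y f x = f (Fin.cons y x) := rfl

theorem δ_apply {n : ℕ} (f : TupleCochain X n) (x : Fin (n + 1) → X) :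
    δ n f x = ∑ i : Fin (n + 1), (-1 : ℝ) ^ (i : ℕ) * f (i.removeNth x) := rfl

/-- Coning off at `y` contracts the augmented complex: deleting the new entry returns `f`, and all
other deletions move past it with one change of sign. -/
theorem slice_δ {n : ℕ} (y : X) (f : TupleCochain X (n + 1)) :
    slice y (δ (n + 1) f) = f - δ n (slice y f) := by
  funext x
  rw [slice_apply, δ_apply, Fin.sum_univ_succ, Pi.sub_apply, δ_apply, sub_eq_add_neg,
    ← Finset.sum_neg_distrib]
  congr 1
  · simp
  · refine Finset.sum_congr rfl fun i _ => ?_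
    rw [slice_apply, ← Fin.cons_comp_succ_succAbove, Fin.val_succ, pow_succ, mul_neg_one, neg_mul]
    rfl

theorem slice_δ_zero (y : X) (f : TupleCochain X 0) : slice y (δ 0 f) = f := by
  funext x
  simp [slice_apply, δ_apply]

theorem ext_slice {n : ℕ} {f g : TupleCochain X (n + 1)} (h : ∀ y, slice y f = slice y g) :
    f = g := by
  funext x
  have := congrFun (h (x 0)) (Fin.tail x)
  rwa [slice_apply, slice_apply, Fin.cons_self_tail] at this

theorem δ_δ : ∀ {n : ℕ} (f : TupleCochain X n), δ (n + 1) (δ n f) = 0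
  | 0, f => ext_slice fun y => by rw [slice_δ, slice_δ_zero, sub_self, map_zero]
  | n + 1, f => ext_slice fun y => by
    rw [slice_δ, slice_δ, map_sub, δ_δ, sub_zero, sub_self, map_zero]

theorem abs_δ_le {n : ℕ} {f : TupleCochain X n} {K : ℝ} (hf : ∀ x, |f x| ≤ K)
    (x : Fin (n + 1) → X) : |δ n f x| ≤ (n + 1) * K := by
  rw [δ_apply]
  refine (Finset.abs_sum_le_sum_abs _ _).trans ?_
  calc _ ≤ ∑ _i : Fin (n + 1), K := Finset.sum_le_sum fun i _ => by
        simpa [abs_mul] using hf (i.removeNth x)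
    _ = (n + 1) * K := by simp

/-- Pulling back along a map of sets. -/
def pull {n : ℕ} (T : X → Y) : TupleCochain Y n →ₗ[ℝ] TupleCochain X n where
  toFun f x := f (T ∘ x)
  map_add' _ _ := rfl
  map_smul' _ _ := rfl

theorem pull_apply {n : ℕ} (T : X → Y) (f : TupleCochain Y n) (x : Fin n → X) :
    pull T f x = f (T ∘ x) := rfl

theorem slice_pull {n : ℕ} (T : X → Y) (f : TupleCochain Y (n + 1)) (y : X) :
    slice y (pull T f) = pull T (slice (T y) f) := by
  funext x
  rw [slice_apply, pull_apply, pull_apply, slice_apply, Fin.comp_cons]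

theorem δ_pull {n : ℕ} (T : X → Y) (f : TupleCochain Y n) :
    δ n (pull T f) = pull T (δ n f) := rfl

/-! #### Averaging each entry of the tuples -/

/-- Averaging a cochain in each entry, with respect to the functional `μ x` at the entry `x`. -/
def average (μ : X → (X → ℝ) →ₗ[ℝ] ℝ) : ∀ n, TupleCochain X n →ₗ[ℝ] TupleCochain X n
  | 0 => LinearMap.id
  | n + 1 =>
    { toFun := fun f x => μ (x 0) fun y => average μ n (slice y f) (Fin.tail x)
      map_add' := fun f g => by
        funext x
        simp only [map_add, Pi.add_apply]
        exact map_add (μ (x 0)) _ _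
      map_smul' := fun r f => by
        funext x
        simp only [map_smul, Pi.smul_apply]
        exact map_smul (μ (x 0)) r _ }

theorem average_succ (μ : X → (X → ℝ) →ₗ[ℝ] ℝ) {n : ℕ} (f : TupleCochain X (n + 1))
    (x : Fin (n + 1) → X) :
    average μ (n + 1) f x = μ (x 0) fun y => average μ n (slice y f) (Fin.tail x) := rfl

/-- A functional whose entry is deleted sees a constant and disappears. The remaining ones keep
their order, so no interchange of means is needed. -/
theorem average_δ {μ : X → (X → ℝ) →ₗ[ℝ] ℝ} (hμ : ∀ x c, μ x (fun _ => c) = c) :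
    ∀ {n : ℕ} (f : TupleCochain X n), average μ (n + 1) (δ n f) = δ n (average μ n f)
  | 0, f => by
    funext x
    rw [average_succ]
    simp only [slice_δ_zero, hμ]
    rw [← slice_δ_zero (x 0) (average μ 0 f), slice_apply, slice_δ_zero, Fin.cons_self_tail]
  | n + 1, f => by
    funext x
    have h : ∀ y, average μ (n + 1) (slice y (δ (n + 1) f)) (Fin.tail x) =
        average μ (n + 1) f (Fin.tail x) - δ n (average μ n (slice y f)) (Fin.tail x) := fun y => by
      rw [slice_δ, map_sub, average_δ hμ, Pi.sub_apply]
    rw [average_succ]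
    simp only [h]
    -- Splitting off `x 0` on the right lets `slice_δ` apply on both sides; the remaining comparison
    -- is linearity of `μ (x 0)` over the finite sum defining `δ n`.
    rw [← Fin.cons_self_tail x, ← slice_apply (x 0) (δ (n + 1) _), slice_δ, Fin.cons_zero,
      Fin.tail_cons, Pi.sub_apply]
    refine (map_sub (μ (x 0)) (fun _ => _) (fun y => _)).trans ?_
    rw [hμ]
    congr 1
    have h' : (fun y => δ n (average μ n (slice y f)) (Fin.tail x)) =
        ∑ i : Fin (n + 1), (-1 : ℝ) ^ (i : ℕ) •
          fun y => average μ n (slice y f) (i.removeNth (Fin.tail x)) := by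
      funext y
      simp [δ_apply]
    rw [h', map_sum, δ_apply]
    refine Finset.sum_congr rfl fun i _ => ?_
    rw [map_smul, smul_eq_mul, slice_apply, average_succ]
    simp

theorem abs_average_le {μ : X → (X → ℝ) →ₗ[ℝ] ℝ}
    (hμ : ∀ x φ K, (∀ y, |φ y| ≤ K) → |μ x φ| ≤ K) :
    ∀ {n : ℕ} {f : TupleCochain X n} {K : ℝ}, (∀ x, |f x| ≤ K) → ∀ x, |average μ n f x| ≤ K
  | 0, _, _, hf, x => hf x
  | _ + 1, _, _, hf, _ => hμ _ _ _ fun y => abs_average_le hμ (fun z => hf (Fin.cons y z)) _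

theorem average_pull {μ : X → (X → ℝ) →ₗ[ℝ] ℝ} {ν : Y → (Y → ℝ) →ₗ[ℝ] ℝ} {T : X → Y}
    (h : ∀ x φ, ν (T x) φ = μ x (φ ∘ T)) :
    ∀ {n : ℕ} (f : TupleCochain Y n), average μ n (pull T f) = pull T (average ν n f)
  | 0, _ => rfl
  | n + 1, f => by
    funext x
    rw [pull_apply, average_succ, average_succ, Function.comp_apply, h]
    congr 1
    funext y
    rw [slice_pull, average_pull h]
    rfl

/-- The averages only depend on the functionals at the entries, evaluated on bounded functions. -/
theorem average_congr {μ : X → (X → ℝ) →ₗ[ℝ] ℝ}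
    (hμ : ∀ x φ K, (∀ y, |φ y| ≤ K) → |μ x φ| ≤ K) :
    ∀ {n : ℕ} {f : TupleCochain X n} {K : ℝ}, (∀ z, |f z| ≤ K) → ∀ x x' : Fin n → X,
      (∀ k φ, (∀ y, |φ y| ≤ K) → μ (x k) φ = μ (x' k) φ) → average μ n f x = average μ n f x'
  | 0, _, _, _, x, x', _ => by rw [Subsingleton.elim x x']
  | n + 1, f, K, hf, x, x', h => by
    have hs : ∀ y z, |slice y f z| ≤ K := fun y z => hf _
    rw [average_succ, average_succ, h 0 _ fun y => abs_average_le hμ (hs y) _]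
    congr 1
    funext y
    exact average_congr hμ (hs y) _ _ fun k => h k.succ

/-! #### Alternating cochains -/

/-- The alternation of a cochain, by expansion along the first entry. -/
def alternate : ∀ n, TupleCochain X n →ₗ[ℝ] TupleCochain X n
  | 0 => LinearMap.id
  | n + 1 =>
    { toFun := fun f x => (n + 1 : ℝ)⁻¹ *
        ∑ i : Fin (n + 1), (-1 : ℝ) ^ (i : ℕ) * alternate n (slice (x i) f) (i.removeNth x)
      map_add' := fun f g => by
        funext x
        simp [mul_add, Finset.sum_add_distrib]
      map_smul' := fun r f => by
        funext x
        simp [Finset.mul_sum, mul_left_comm] }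

theorem alternate_succ {n : ℕ} (f : TupleCochain X (n + 1)) (x : Fin (n + 1) → X) :
    alternate (n + 1) f x = (n + 1 : ℝ)⁻¹ *
      ∑ i : Fin (n + 1), (-1 : ℝ) ^ (i : ℕ) * alternate n (slice (x i) f) (i.removeNth x) := rfl

/-- Both sums run over ordered pairs of distinct entries of `x`; exchanging the roles of the two
entries leaves the tuple of remaining entries unchanged and flips the sign. -/
theorem sum_removeNth_swap {n : ℕ} (F : X → (Fin n → X) → ℝ) (x : Fin (n + 2) → X) :
    ∑ i : Fin (n + 2), ∑ j : Fin (n + 1), (-1 : ℝ) ^ (i + j : ℕ) *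
        F (x i) (j.removeNth (i.removeNth x)) =
      -∑ i : Fin (n + 2), ∑ j : Fin (n + 1), (-1 : ℝ) ^ (i + j : ℕ) *
        F (i.removeNth x j) (j.removeNth (i.removeNth x)) := by
  rw [← Finset.sum_neg_distrib]
  simp only [← Finset.sum_neg_distrib, ← Fintype.sum_prod_type']
  -- The pair `(i, j)` means: delete entry `i`, then entry `j` of what is left. Its image deletes
  -- the same two entries in the opposite order, so the map is an involution.
  refine Finset.sum_bij' (fun p _ => (p.1.succAbove p.2, p.2.predAbove p.1))
    (fun p _ => (p.1.succAbove p.2, p.2.predAbove p.1)) (fun _ _ => Finset.mem_univ _)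
    (fun _ _ => Finset.mem_univ _) ?_ ?_ ?_
  · rintro ⟨i, j⟩ -
    simp [Fin.succAbove_succAbove_predAbove, Fin.predAbove_predAbove_succAbove]
  · rintro ⟨i, j⟩ -
    simp [Fin.succAbove_succAbove_predAbove, Fin.predAbove_predAbove_succAbove]
  · rintro ⟨i, j⟩ -
    dsimp only
    rw [Fin.neg_one_pow_succAbove_add_predAbove, ← Fin.removeNth_removeNth_eq_swap,
      Fin.removeNth_apply, Fin.succAbove_succAbove_predAbove]
    ring

/-- Expansion along the first entry and `slice_δ` give one copy of `δ (alternate f)` minus a double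
sum. By the swap identity the latter contributes `n + 1` further copies, and the total of `n + 2`
cancels the normalization. -/
theorem alternate_δ : ∀ {n : ℕ} (f : TupleCochain X n),
    alternate (n + 1) (δ n f) = δ n (alternate n f)
  | 0, f => by
    funext x
    rw [alternate_succ]
    simp only [slice_δ_zero]
    simp [δ_apply]
  | n + 1, f => by
    funext x
    rw [alternate_succ]
    have h : ∀ i : Fin (n + 2), alternate (n + 1) (slice (x i) (δ (n + 1) f)) (i.removeNth x) =
        alternate (n + 1) f (i.removeNth x) -
          δ n (alternate n (slice (x i) f)) (i.removeNth x) := fun i => by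
      rw [slice_δ, map_sub, alternate_δ, Pi.sub_apply]
    have h1 : ∑ i : Fin (n + 2), (-1 : ℝ) ^ (i : ℕ) *
        δ n (alternate n (slice (x i) f)) (i.removeNth x) =
        ∑ i : Fin (n + 2), ∑ j : Fin (n + 1), (-1 : ℝ) ^ (i + j : ℕ) *
          alternate n (slice (x i) f) (j.removeNth (i.removeNth x)) := by
      simp only [δ_apply, Finset.mul_sum, pow_add, mul_assoc]
    have h2 : δ (n + 1) (alternate (n + 1) f) x = (n + 1 : ℝ)⁻¹ *
        ∑ i : Fin (n + 2), ∑ j : Fin (n + 1), (-1 : ℝ) ^ (i + j : ℕ) *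
          alternate n (slice (i.removeNth x j) f) (j.removeNth (i.removeNth x)) := by
      simp only [δ_apply, alternate_succ, Finset.mul_sum, pow_add, mul_assoc, mul_left_comm]
    simp only [h, mul_sub, Finset.sum_sub_distrib]
    rw [h1, sum_removeNth_swap (fun y z => alternate n (slice y f) z), ← δ_apply,
      ← (eq_inv_mul_iff_mul_eq₀ (by positivity)).1 h2]
    push_cast
    field_simp
    ring

theorem abs_alternate_le : ∀ {n : ℕ} {f : TupleCochain X n} {K : ℝ}, (∀ x, |f x| ≤ K) →
    ∀ x, |alternate n f x| ≤ K
  | 0, _, _, hf, x => hf x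
  | n + 1, f, K, hf, x => by
    rw [alternate_succ, abs_mul, abs_of_nonneg (by positivity : (0 : ℝ) ≤ (n + 1 : ℝ)⁻¹),
      inv_mul_le_iff₀ (by positivity)]
    refine (Finset.abs_sum_le_sum_abs _ _).trans ?_
    calc _ ≤ ∑ _i : Fin (n + 1), K := Finset.sum_le_sum fun i _ => by
          simpa [abs_mul] using abs_alternate_le (f := slice (x i) f) (fun z => hf _) (i.removeNth x)
      _ = (n + 1) * K := by simp

theorem alternate_pull (T : X → Y) : ∀ {n : ℕ} (f : TupleCochain Y n),
    alternate n (pull T f) = pull T (alternate n f)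
  | 0, _ => rfl
  | n + 1, f => by
    funext x
    rw [pull_apply, alternate_succ, alternate_succ]
    simp only [slice_pull, alternate_pull T]
    rfl

/-- The alternation of a cochain of positive degree vanishes on tuples from a subset on which the
cochain is constant. -/
theorem alternate_eq_zero_of_const {S : Set X} : ∀ {n : ℕ} {f : TupleCochain X (n + 2)} {c : ℝ},
    (∀ x, (∀ k, x k ∈ S) → f x = c) → ∀ x, (∀ k, x k ∈ S) → alternate (n + 2) f x = 0
  | 0, f, c, hf, x, hx => by
    rw [alternate_succ]
    have h : ∀ i j : Fin 2, ∀ z : Fin 0 → X,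
        alternate 0 (slice (x j) (slice (x i) f)) z = c := fun i j z =>
      hf _ (Fin.cases (hx i) (Fin.cases (hx j) fun k => k.elim0))
    simp [Fin.sum_univ_two, alternate_succ, Fin.removeNth_apply, h]
  | n + 1, f, c, hf, x, hx => by
    rw [alternate_succ, Finset.sum_eq_zero, mul_zero]
    intro i _
    rw [alternate_eq_zero_of_const (S := S) (c := c), mul_zero]
    · exact fun z hz => hf _ (Fin.cases (hx i) hz)
    · exact fun k => hx _

/-! #### Homotopies -/

/-- The cone homotopy between a family `Q` of operators and the identity. -/
def homotopy (Q : ∀ n, TupleCochain X n →ₗ[ℝ] TupleCochain X n) :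
    ∀ n, TupleCochain X (n + 1) →ₗ[ℝ] TupleCochain X n
  | 0 => 0
  | n + 1 =>
    -- The cone point is the first entry of the tuple itself. A fixed cone point would not be
    -- compatible with left multiplication.
    { toFun := fun g x => Q (n + 1) (slice (x 0) g) x - slice (x 0) g x -
        δ n (homotopy Q n (slice (x 0) g)) x
      map_add' := fun f g => by
        funext x
        simp only [map_add, Pi.add_apply]
        ring
      map_smul' := fun r f => by
        funext x
        simp only [map_smul, Pi.smul_apply, RingHom.id_apply, smul_eq_mul]
        ring }

variable {Q : ∀ n, TupleCochain X n →ₗ[ℝ] TupleCochain X n}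

theorem homotopy_succ {n : ℕ} (g : TupleCochain X (n + 2)) (x : Fin (n + 1) → X) :
    homotopy Q (n + 1) g x = Q (n + 1) (slice (x 0) g) x - slice (x 0) g x -
      δ n (homotopy Q n (slice (x 0) g)) x := rfl

/-- Inductively `homotopy ∘ δ + δ ∘ homotopy = Q - id` holds (this is `key`); applying `δ` removes
the second term. -/
theorem δ_homotopy_δ (hQ₀ : ∀ f, Q 0 f = f) (hQ : ∀ n f, Q (n + 1) (δ n f) = δ n (Q n f)) :
    ∀ {n : ℕ} (f : TupleCochain X n), δ n (homotopy Q n (δ n f)) = Q (n + 1) (δ n f) - δ n f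
  | 0, f => by
    rw [hQ, hQ₀, sub_self]
    exact map_zero (δ 0)
  | n + 1, f => by
    have key : homotopy Q (n + 1) (δ (n + 1) f) = Q (n + 1) f - f - δ n (homotopy Q n f) := by
      funext x
      rw [homotopy_succ, slice_δ]
      simp only [map_sub]
      -- The induction hypothesis for `slice (x 0) f` cancels every term containing this slice.
      rw [δ_homotopy_δ hQ₀ hQ]
      simp only [Pi.sub_apply]
      ring
    rw [key, map_sub, map_sub, δ_δ, sub_zero, hQ]

/-- The augmented complex is exact, so a cocycle is a coboundary and `δ_homotopy_δ` applies. The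
primitive need not be equivariant, since it serves only to verify an identity for the already
constructed homotopy. -/
theorem δ_homotopy (hQ₀ : ∀ f, Q 0 f = f) (hQ : ∀ n f, Q (n + 1) (δ n f) = δ n (Q n f))
    {n : ℕ} {f : TupleCochain X (n + 1)} (hf : δ (n + 1) f = 0) :
    δ n (homotopy Q n f) = Q (n + 1) f - f := by
  rcases isEmpty_or_nonempty X with hX | ⟨⟨y⟩⟩
  · funext x
    exact isEmptyElim (x 0)
  · have h : f = δ n (slice y f) := by
      rw [← sub_eq_zero, ← slice_δ, hf, map_zero]
    rw [h, δ_homotopy_δ hQ₀ hQ]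

/-- The norm of the cone homotopy in degree `n`. -/
def homotopyBound : ℕ → ℝ
  | 0 => 0
  | n + 1 => 2 + (n + 1) * homotopyBound n

theorem homotopyBound_nonneg : ∀ n, 0 ≤ homotopyBound n
  | 0 => le_rfl
  | n + 1 => add_nonneg zero_le_two (mul_nonneg (by positivity) (homotopyBound_nonneg n))

theorem abs_homotopy_le (hQ : ∀ (n : ℕ) (f : TupleCochain X n) (K : ℝ), (∀ x, |f x| ≤ K) →
    ∀ x, |Q n f x| ≤ K) : ∀ (n : ℕ) (f : TupleCochain X (n + 1)) (K : ℝ),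
    (∀ x, |f x| ≤ K) → ∀ x, |homotopy Q n f x| ≤ homotopyBound n * K
  | 0, f, K, _, x => by simp [homotopy, homotopyBound]
  | n + 1, f, K, hf, x => by
    have hs : ∀ z, |slice (x 0) f z| ≤ K := fun z => hf _
    have h₁ := hQ _ _ _ hs x
    have h₂ := abs_δ_le (abs_homotopy_le hQ n _ _ hs) x
    rw [homotopy_succ]
    refine (abs_sub _ _).trans ((add_le_add ((abs_sub _ _).trans (add_le_add h₁ (hs x))) h₂).trans
      (le_of_eq ?_))
    rw [homotopyBound]
    ring

theorem homotopy_pull {R : ∀ n, TupleCochain Y n →ₗ[ℝ] TupleCochain Y n} {T : X → Y}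
    (h : ∀ (n : ℕ) (f : TupleCochain Y n), Q n (pull T f) = pull T (R n f)) :
    ∀ {n : ℕ} (f : TupleCochain Y (n + 1)),
      homotopy Q n (pull T f) = pull T (homotopy R n f)
  | 0, _ => rfl
  | n + 1, f => by
    funext x
    rw [pull_apply, homotopy_succ, homotopy_succ, slice_pull, h, homotopy_pull h, δ_pull]
    rfl

end TupleCochain
end

noncomputable section

namespace BoundedCohomology

/-! ### Bounded cochains as families of functions on tuples -/

section Tuples

variable {G : Type u} [Groupoid.{v} G]

theorem EndingIn.mul_mul {e f k : G} (h : e ⟶ f) (g : f ⟶ k) (x : EndingIn e) :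
    EndingIn.mul g (EndingIn.mul h x) = EndingIn.mul (h ≫ g) x := by
  simp [EndingIn.mul]

theorem EndingIn.id_mul {e : G} (x : EndingIn e) : EndingIn.mul (𝟙 e) x = x := by
  simp [EndingIn.mul]

theorem EndingIn.mul_comp_mul {n : ℕ} {e f k : G} (h : e ⟶ f) (g : f ⟶ k)
    (x : Fin n → EndingIn e) :
    EndingIn.mul g ∘ EndingIn.mul h ∘ x = EndingIn.mul (h ≫ g) ∘ x :=
  funext fun _ => EndingIn.mul_mul _ _ _

theorem EndingIn.id_mul_comp {n : ℕ} {e : G} (x : Fin n → EndingIn e) :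
    EndingIn.mul (𝟙 e) ∘ x = x :=
  funext fun _ => EndingIn.id_mul _

/-- The homogeneous tuple `(g₀, g₀ g₁, …, g₀ ⋯ gₙ)` of a path `(g₀, …, gₙ)`. -/
def BarPath.tuple : ∀ {n : ℕ} {e : G}, BarPath n e → Fin (n + 1) → EndingIn e
  | _, _, .single g => fun _ => ⟨_, g⟩
  | _, _, .cons g p => Fin.cons ⟨_, g⟩ (EndingIn.mul g ∘ p.tuple)

/-- The path with a given homogeneous tuple. -/
def BarPath.ofTuple : ∀ {n : ℕ} {e : G}, (Fin (n + 1) → EndingIn e) → BarPath n e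
  | 0, _, x => .single (x 0).2
  | _ + 1, _, x => .cons (x 0).2 (ofTuple (EndingIn.mul (Groupoid.inv (x 0).2) ∘ Fin.tail x))

theorem BarPath.tuple_cons {n : ℕ} {e f : G} (g : f ⟶ e) (p : BarPath n f) :
    (BarPath.cons g p).tuple = Fin.cons ⟨_, g⟩ (EndingIn.mul g ∘ p.tuple) := rfl

theorem BarPath.ofTuple_tuple : ∀ {n : ℕ} {e : G} (p : BarPath n e), ofTuple p.tuple = p
  | _, _, .single g => rfl
  | _, _, .cons g p => by
    change BarPath.cons g (ofTuple (EndingIn.mul (Groupoid.inv g) ∘ EndingIn.mul g ∘ p.tuple)) = _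
    rw [EndingIn.mul_comp_mul, Groupoid.comp_inv, EndingIn.id_mul_comp, ofTuple_tuple]

theorem BarPath.tuple_ofTuple : ∀ {n : ℕ} {e : G} (x : Fin (n + 1) → EndingIn e),
    (ofTuple x).tuple = x
  | 0, _, x => funext fun k => by
    rw [Fin.fin_one_eq_zero k]
    rfl
  | n + 1, e, x => by
    rw [ofTuple, tuple_cons, tuple_ofTuple, EndingIn.mul_comp_mul, Groupoid.inv_comp,
      EndingIn.id_mul_comp]
    exact Fin.cons_self_tail x

/-- The action, which changes only the first morphism of a path, becomes diagonal in homogeneous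
coordinates. -/
theorem BarPath.tuple_mul {n : ℕ} {e f : G} (g : e ⟶ f) (p : BarPath n e) :
    (p.mul g).tuple = EndingIn.mul g ∘ p.tuple := by
  cases p with
  | single h => rfl
  | cons h p =>
    rw [mul_cons, tuple_cons, tuple_cons, Fin.comp_cons, EndingIn.mul_comp_mul]
    rfl

theorem BarPath.ofTuple_mul {n : ℕ} {e f : G} (g : e ⟶ f) (x : Fin (n + 1) → EndingIn e) :
    ofTuple (EndingIn.mul g ∘ x) = (ofTuple x).mul g := by
  rw [← ofTuple_tuple ((ofTuple x).mul g), tuple_mul, tuple_ofTuple]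

/-- Composing two neighbours in a path omits one partial product, and dropping the last morphism
omits the last one; all faces thus become deletions. -/
theorem BarPath.tuple_face : ∀ {n : ℕ} {e : G} (i : Fin (n + 2)) (p : BarPath (n + 1) e),
    (p.face i).tuple = i.removeNth p.tuple
  | n, _, i, .cons g p => by
    refine Fin.cases ?_ (fun j => ?_) i
    · rw [face_zero_cons, tuple_mul, Fin.removeNth_zero, tuple_cons, Fin.tail_cons]
    · rw [tuple_cons]
      change _ = Fin.cons _ _ ∘ j.succ.succAbove
      cases n with
      | zero =>
        rw [face_succ_cons_zero]
        funext k
        rw [Fin.fin_one_eq_zero k, Fin.fin_one_eq_zero j]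
        rfl
      | succ n =>
        rw [face_succ_cons, tuple_cons, tuple_face, Fin.cons_comp_succ_succAbove]
        rfl

theorem BarPath.ofTuple_removeNth {n : ℕ} {e : G} (i : Fin (n + 2))
    (x : Fin (n + 2) → EndingIn e) : ofTuple (i.removeNth x) = (ofTuple x).face i := by
  rw [← ofTuple_tuple ((ofTuple x).face i), tuple_face, tuple_ofTuple]

/-- The map of morphisms ending in a given object induced by a functor. -/
def EndingIn.map {A : Type u'} [Groupoid.{v'} A] (F : A ⥤ G) {a : A} (h : EndingIn a) :
    EndingIn (F.obj a) := ⟨F.obj h.1, F.map h.2⟩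

theorem EndingIn.map_mul {A : Type u'} [Groupoid.{v'} A] (F : A ⥤ G) {a b : A} (g : a ⟶ b)
    (h : EndingIn a) :
    EndingIn.map F (EndingIn.mul g h) = EndingIn.mul (F.map g) (EndingIn.map F h) := by
  simp [EndingIn.mul, EndingIn.map]

theorem BarPath.tuple_map {A : Type u'} [Groupoid.{v'} A] (F : A ⥤ G) :
    ∀ {n : ℕ} {a : A} (p : BarPath n a), (p.map F).tuple = EndingIn.map F ∘ p.tuple
  | _, _, .single g => rfl
  | _, _, .cons g p => by
    rw [BarPath.map, tuple_cons, tuple_cons, Fin.comp_cons, tuple_map]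
    congr 1
    funext k
    exact (EndingIn.map_mul F g _).symm

end Tuples

/-! ### Bounded linear maps out of free `ℓ¹`-modules -/

section Lift

variable {P : Type w} {E : Type w'} [NormedAddCommGroup E] [NormedSpace ℝ E]

/-- The bounded linear map with prescribed, uniformly bounded, values on the basis elements. -/
def FreeL1.lift (f : P → E) (K : ℝ) (hf : ∀ p, ‖f p‖ ≤ K) : FreeL1 P →L[ℝ] E :=
  LinearMap.mkContinuous (Finsupp.linearCombination ℝ f : FreeL1 P →ₗ[ℝ] E) K fun x => by
    refine (norm_sum_le (Finsupp.support (M := ℝ) x) fun p => (show P →₀ ℝ from x) p • f p).trans ?_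
    rw [FreeL1.norm_eq_sum x _ (Finset.Subset.refl _), Finset.mul_sum]
    refine Finset.sum_le_sum fun p _ => ?_
    rw [norm_smul, mul_comm K, Real.norm_eq_abs]
    exact mul_le_mul_of_nonneg_left (hf p) (abs_nonneg _)

theorem FreeL1.lift_of (f : P → E) (K : ℝ) (hf : ∀ p, ‖f p‖ ≤ K) (p : P) :
    FreeL1.lift f K hf (FreeL1.of p) = f p := by
  change Finsupp.linearCombination ℝ f (Finsupp.single p 1) = f p
  simp

theorem FreeL1.norm_lift_le (f : P → E) {K : ℝ} (hK : 0 ≤ K) (hf : ∀ p, ‖f p‖ ≤ K) :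
    ‖FreeL1.lift f K hf‖ ≤ K :=
  LinearMap.mkContinuous_norm_le _ hK _

theorem FreeL1.norm_of (p : P) : ‖FreeL1.of p‖ = 1 :=
  (Finsupp.sum_single_index (by simp)).trans abs_one

end Lift

/-! ### Dictionary between dual-valued cochains and functions on tuples -/

section Families

variable {G : Type u} [Groupoid.{v} G] {V : NormedMod.{v, u, w} G}

/-- The functions on homogeneous tuples of a cochain with values in a dual module. -/
def BddCochain.eval {n : ℕ} (φ : BddCochain (dualMod V) n) (e : G) :
    V e →ₗ[ℝ] TupleCochain (EndingIn e) (n + 1) where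
  toFun y x := (φ.at e (FreeL1.of (BarPath.ofTuple x)) : V e →L[ℝ] ℝ) y
  map_add' y z := funext fun x =>
    map_add (φ.at e (FreeL1.of (BarPath.ofTuple x)) : V e →L[ℝ] ℝ) y z
  map_smul' r y := funext fun x =>
    map_smul (φ.at e (FreeL1.of (BarPath.ofTuple x)) : V e →L[ℝ] ℝ) r y

namespace BddCochain

variable {n : ℕ}

theorem eval_apply (φ : BddCochain (dualMod V) n) (e : G) (y : V e)
    (x : Fin (n + 1) → EndingIn e) :
    φ.eval e y x = (φ.at e (FreeL1.of (BarPath.ofTuple x)) : V e →L[ℝ] ℝ) y := rfl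

theorem eval_tuple (φ : BddCochain (dualMod V) n) {e : G} (y : V e) (p : BarPath n e) :
    φ.eval e y p.tuple = (φ.at e (FreeL1.of p) : V e →L[ℝ] ℝ) y := by
  rw [eval_apply, BarPath.ofTuple_tuple]

theorem ext_eval {φ ψ : BddCochain (dualMod V) n} (h : ∀ e y, φ.eval e y = ψ.eval e y) :
    φ = ψ := by
  refine Subtype.ext (lp.ext (funext fun e => FreeL1.hom_ext_apply fun p => ?_))
  refine ContinuousLinearMap.ext fun y => ?_
  exact (eval_tuple φ y p).symm.trans ((congrFun (h e y) _).trans (eval_tuple ψ y p))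

theorem abs_eval_le (φ : BddCochain (dualMod V) n) (e : G) (y : V e)
    (x : Fin (n + 1) → EndingIn e) : |φ.eval e y x| ≤ ‖φ‖ * ‖y‖ := by
  refine (ContinuousLinearMap.le_opNorm (φ.at e (FreeL1.of (BarPath.ofTuple x)) : V e →L[ℝ] ℝ)
    y).trans (mul_le_mul_of_nonneg_right ?_ (norm_nonneg _))
  refine ((φ.at e).le_opNorm _).trans ?_
  refine (mul_le_mul (φ.norm_at_le e) (FreeL1.norm_of _).le (norm_nonneg _) (norm_nonneg _)).trans
    (mul_one _).le

/-- The inverse in the dual action cancels the action on the vector, so equivariance becomes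
invariance under moving tuple and vector together. -/
theorem eval_act (φ : BddCochain (dualMod V) n) {e f : G} (g : e ⟶ f) (y : V e) :
    TupleCochain.pull (EndingIn.mul g) (φ.eval f (V.act g y)) = φ.eval e y := by
  funext x
  rw [TupleCochain.pull_apply, eval_apply, BarPath.ofTuple_mul, ← barMod_act_of,
    φ.equivariant]
  change (φ.at e (FreeL1.of (BarPath.ofTuple x)) : V e →L[ℝ] ℝ)
    (V.act (Groupoid.inv g) (V.act g y)) = _
  rw [V.act_inv_act]
  rfl

/-- The bounded linear map into a dual space given by a bounded family of functions on tuples. -/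
def ofEvalAt {e : G} (F : V e →ₗ[ℝ] TupleCochain (EndingIn e) (n + 1)) (K : ℝ) (hK : 0 ≤ K)
    (hF : ∀ y x, |F y x| ≤ K * ‖y‖) : FreeL1 (BarPath n e) →L[ℝ] V e →L[ℝ] ℝ :=
  FreeL1.lift
    (fun p => LinearMap.mkContinuous (LinearMap.proj p.tuple ∘ₗ F) K fun y => hF y p.tuple) K
    fun p => LinearMap.mkContinuous_norm_le _ hK fun y => hF y p.tuple

theorem ofEvalAt_of {e : G} {F : V e →ₗ[ℝ] TupleCochain (EndingIn e) (n + 1)} {K : ℝ} {hK : 0 ≤ K}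
    {hF : ∀ y x, |F y x| ≤ K * ‖y‖} (p : BarPath n e) (y : V e) :
    ofEvalAt F K hK hF (FreeL1.of p) y = F y p.tuple := by
  rw [ofEvalAt, FreeL1.lift_of]
  rfl

theorem norm_ofEvalAt_le {e : G} {F : V e →ₗ[ℝ] TupleCochain (EndingIn e) (n + 1)} {K : ℝ}
    {hK : 0 ≤ K} {hF : ∀ y x, |F y x| ≤ K * ‖y‖} : ‖ofEvalAt F K hK hF‖ ≤ K :=
  FreeL1.norm_lift_le _ hK _

/-- A cochain is given by an equivariant, uniformly bounded family of functions on tuples. -/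
def ofEval (F : ∀ e, V e →ₗ[ℝ] TupleCochain (EndingIn e) (n + 1)) (K : ℝ) (hK : 0 ≤ K)
    (hF : ∀ e y x, |F e y x| ≤ K * ‖y‖)
    (hact : ∀ {e f : G} (g : e ⟶ f) (y : V e),
      TupleCochain.pull (EndingIn.mul g) (F f (V.act g y)) = F e y) :
    BddCochain (dualMod V) n :=
  ⟨⟨fun e => ofEvalAt (F e) K hK (hF e), by
      refine memℓp_infty ⟨K, ?_⟩
      rintro _ ⟨e, rfl⟩
      exact norm_ofEvalAt_le⟩, by
    intro e f g
    refine FreeL1.hom_ext_apply fun p => ContinuousLinearMap.ext fun y => ?_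
    change ofEvalAt (F e) K hK (hF e) ((barMod G n).act (Groupoid.inv g) (FreeL1.of p))
      (V.act (Groupoid.inv g) y) = ofEvalAt (F f) K hK (hF f) (FreeL1.of p) y
    rw [barMod_act_of, ofEvalAt_of, ofEvalAt_of, BarPath.tuple_mul, ← hact (Groupoid.inv g) y]
    rfl⟩

section ofEval

variable {F : ∀ e, V e →ₗ[ℝ] TupleCochain (EndingIn e) (n + 1)} {K : ℝ} {hK : 0 ≤ K}
    {hF : ∀ e y x, |F e y x| ≤ K * ‖y‖}
    {hact : ∀ {e f : G} (g : e ⟶ f) (y : V e),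
      TupleCochain.pull (EndingIn.mul g) (F f (V.act g y)) = F e y}

theorem eval_ofEval (e : G) (y : V e) : (ofEval F K hK hF hact).eval e y = F e y := by
  funext x
  rw [eval_apply]
  change ofEvalAt (F e) K hK (hF e) (FreeL1.of _) y = _
  rw [ofEvalAt_of, BarPath.tuple_ofTuple]

theorem norm_ofEval_le : ‖ofEval F K hK hF hact‖ ≤ K :=
  lp.norm_le_of_forall_le hK fun e => norm_ofEvalAt_le (hK := hK) (hF := hF e)

end ofEval

theorem eval_d (φ : BddCochain (dualMod V) n) (e : G) (y : V e) :
    (bddDifferentialₗ (dualMod V) n φ).eval e y = TupleCochain.δ (n + 1) (φ.eval e y) := by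
  funext x
  rw [TupleCochain.δ_apply]
  change (φ.at e (barBoundary n e (FreeL1.of (BarPath.ofTuple x))) : V e →L[ℝ] ℝ) y = _
  rw [barBoundary_of, map_sum]
  refine (map_sum (ContinuousLinearMap.apply ℝ ℝ y) _ _).trans
    (Finset.sum_congr rfl fun j _ => ?_)
  rw [map_smul, eval_apply, BarPath.ofTuple_removeNth]
  rfl

theorem eval_sub (φ ψ : BddCochain (dualMod V) n) (e : G) (y : V e) :
    (φ - ψ).eval e y = φ.eval e y - ψ.eval e y := rfl

variable {A : Type u'} [Groupoid.{v'} A]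

theorem mem_relCochain_iff {i : A ⥤ G} {φ : BddCochain (dualMod V) n} :
    φ ∈ relCochain i (dualMod V) n ↔ ∀ (a : A) (y : V (i.obj a)) (x : Fin (n + 1) → EndingIn a),
      φ.eval (i.obj a) y (EndingIn.map i ∘ x) = 0 := by
  have h : ∀ (a : A) (y : V (i.obj a)) (p : BarPath n a),
      φ.eval (i.obj a) y (EndingIn.map i ∘ p.tuple) =
        (φ.at (i.obj a) (barMap i n a (FreeL1.of p)) : V (i.obj a) →L[ℝ] ℝ) y := fun a y p => by
    rw [← BarPath.tuple_map, eval_tuple, barMap_of]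
  constructor
  · intro hφ a y x
    rw [← BarPath.tuple_ofTuple x, h]
    have h' : φ.at (i.obj a) (barMap i n a (FreeL1.of (BarPath.ofTuple x))) = 0 :=
      DFunLike.congr_fun (hφ a) (FreeL1.of (BarPath.ofTuple x))
    rw [h']
    rfl
  · intro hφ a
    refine FreeL1.hom_ext_apply fun p => ContinuousLinearMap.ext fun y => ?_
    exact (h a y p).symm.trans (hφ a y p.tuple)

end BddCochain

end Families

end BoundedCohomology
end

noncomputable section

namespace BoundedCohomology

/-! ### Averaging over an amenable subgroupoid -/

section Mean

variable {G : Type u} [Groupoid.{v} G] {A : Type u'} [Groupoid.{v'} A]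

/-- An invariant mean extends (non-canonically) to a family of linear functionals on the spaces of
all, possibly unbounded, functions. -/
theorem InvariantMean.exists_extension (M : InvariantMean A) :
    ∃ L : ∀ a : A, (EndingIn a → ℝ) →ₗ[ℝ] ℝ, (∀ a c, L a (fun _ => c) = c) ∧
      (∀ a φ K, (∀ h, |φ h| ≤ K) → |L a φ| ≤ K) ∧
      ∀ {a b : A} (g : b ⟶ a) φ K, (∀ h, |φ h| ≤ K) → L a φ = L b (φ ∘ EndingIn.mul g) := by
  -- A linear left inverse of the inclusion of bounded functions into all functions extends the
  -- mean. The averaging operators can then be defined without carrying boundedness proofs;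
  -- boundedness is needed only for estimates and invariance.
  let ι : ∀ a : A, lp (fun _ : EndingIn a => ℝ) ∞ →ₗ[ℝ] (EndingIn a → ℝ) := fun a =>
    { toFun := fun φ => φ
      map_add' := fun _ _ => rfl
      map_smul' := fun _ _ => rfl }
  have hι : ∀ a, ∃ r : (EndingIn a → ℝ) →ₗ[ℝ] lp (fun _ : EndingIn a => ℝ) ∞,
      r ∘ₗ ι a = LinearMap.id := fun a =>
    (ι a).exists_leftInverse_of_injective (LinearMap.ker_eq_bot.2 fun _ _ h => lp.ext h)
  choose r hr using hι
  let bdd : ∀ {a : A} (φ : EndingIn a → ℝ) (K : ℝ), (∀ h, |φ h| ≤ K) →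
      lp (fun _ : EndingIn a => ℝ) ∞ := fun φ K hφ =>
    ⟨φ, memℓp_infty ⟨K, by rintro _ ⟨h, rfl⟩; exact hφ h⟩⟩
  have hbdd : ∀ {a : A} (φ : EndingIn a → ℝ) (K : ℝ) (hφ : ∀ h, |φ h| ≤ K),
      r a φ = bdd φ K hφ := fun φ K hφ => LinearMap.congr_fun (hr _) (bdd φ K hφ)
  refine ⟨fun a => (M.mean a).toLinearMap ∘ₗ r a, fun a c => ?_, fun a φ K hφ => ?_,
    fun {a b} g φ K hφ => ?_⟩
  · change M.mean a (r a fun _ => c) = c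
    rw [hbdd _ |c| fun _ => le_rfl]
    exact M.mean_const a c
  · change |M.mean a (r a φ)| ≤ K
    rw [hbdd φ K hφ]
    -- The identity of `a` shows that the index set is nonempty.
    have hK : 0 ≤ K := (abs_nonneg _).trans (hφ ⟨a, 𝟙 a⟩)
    refine ((M.mean a).le_opNorm _).trans ?_
    rw [M.norm_mean, one_mul]
    exact lp.norm_le_of_forall_le hK hφ
  · change M.mean a (r a φ) = M.mean b (r b _)
    rw [hbdd φ K hφ, hbdd (φ ∘ EndingIn.mul g) K fun _ => hφ _]
    refine Eq.trans ?_ (M.equivariant g _)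
    congr 1
    refine lp.ext (funext fun h => ?_)
    change φ h = φ (EndingIn.mul g (EndingIn.mul (Groupoid.inv g) h))
    rw [EndingIn.mul_mul, Groupoid.inv_comp, EndingIn.id_mul]

/-- A family of means on the functions on the morphisms of `G` with a given target, which is
invariant under `A` and concentrated on the morphisms of `A` at the objects of `A`. -/
structure RelativeMean (i : A ⥤ G) where
  mean : ∀ e : G, (EndingIn e → ℝ) →ₗ[ℝ] ℝ
  mean_const : ∀ e c, mean e (fun _ => c) = c
  abs_mean_le : ∀ e φ K, (∀ h, |φ h| ≤ K) → |mean e φ| ≤ K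
  -- Invariance is limited to bounded functions because the extension to unbounded ones is
  -- arbitrary.
  mean_mul : ∀ {a b : A} (g : b ⟶ a) φ K, (∀ h, |φ h| ≤ K) →
    mean (i.obj b) (φ ∘ EndingIn.mul (i.map g)) = mean (i.obj a) φ
  mean_congr : ∀ a φ ψ, (∀ h : EndingIn a, φ (EndingIn.map i h) = ψ (EndingIn.map i h)) →
    mean (i.obj a) φ = mean (i.obj a) ψ

/-- Precomposition with the inclusion of morphisms pushes the mean forward to the image of `A`;
injectivity on objects makes it well defined. Elsewhere no invariance is required and a point mass
suffices. -/
theorem IsAmenable.nonempty_relativeMean (hA : IsAmenable A) {i : A ⥤ G}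
    (hi : Function.Injective i.obj) : Nonempty (RelativeMean i) := by
  obtain ⟨M⟩ := hA
  obtain ⟨L, hL₁, hL₂, hL₃⟩ := M.exists_extension
  have h : ∀ e : G, ∃ m : (EndingIn e → ℝ) →ₗ[ℝ] ℝ, (∀ c, m (fun _ => c) = c) ∧
      (∀ φ K, (∀ h, |φ h| ≤ K) → |m φ| ≤ K) ∧
      ∀ (a : A) (ha : i.obj a = e), m = ha ▸ L a ∘ₗ LinearMap.funLeft ℝ ℝ (EndingIn.map i) := by
    intro e
    by_cases he : ∃ a, i.obj a = e
    · obtain ⟨a, rfl⟩ := he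
      refine ⟨L a ∘ₗ LinearMap.funLeft ℝ ℝ (EndingIn.map i), hL₁ a,
        fun φ K hφ => hL₂ a _ K fun _ => hφ _, fun b hb => ?_⟩
      obtain rfl := hi hb
      rfl
    -- Evaluation at the identity of `e`.
    · exact ⟨LinearMap.proj ⟨e, 𝟙 e⟩, fun c => rfl, fun φ K hφ => hφ _,
        fun a ha => absurd ⟨a, ha⟩ he⟩
  choose m hm₁ hm₂ hm₃ using h
  have hm : ∀ a φ, m (i.obj a) φ = L a (φ ∘ EndingIn.map i) := fun a φ => by
    rw [hm₃ _ a rfl]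
    rfl
  refine ⟨⟨m, hm₁, hm₂, fun {a b} g φ K hφ => ?_, fun a φ ψ h => ?_⟩⟩
  · rw [hm, hm, hL₃ g (φ ∘ EndingIn.map i) K fun _ => hφ _]
    congr 1
    funext h
    simp only [Function.comp_apply, EndingIn.map_mul]
  · rw [hm, hm]
    congr 1
    exact funext h

namespace RelativeMean

variable {i : A ⥤ G} (m : RelativeMean i)

/-- The mean over the translate by `x` of the mean at the source of `x`. -/
def translate {e : G} (x : EndingIn e) : (EndingIn e → ℝ) →ₗ[ℝ] ℝ :=
  m.mean x.1 ∘ₗ LinearMap.funLeft ℝ ℝ (EndingIn.mul x.2)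

theorem translate_apply {e : G} (x : EndingIn e) (φ : EndingIn e → ℝ) :
    m.translate x φ = m.mean x.1 (φ ∘ EndingIn.mul x.2) := rfl

theorem translate_const {e : G} (x : EndingIn e) (c : ℝ) : m.translate x (fun _ => c) = c :=
  m.mean_const _ c

theorem abs_translate_le {e : G} (x : EndingIn e) (φ : EndingIn e → ℝ) (K : ℝ)
    (hφ : ∀ h, |φ h| ≤ K) : |m.translate x φ| ≤ K :=
  m.abs_mean_le _ _ K fun _ => hφ _

/-- Translates depend naturally on `x`, which makes the averages equivariant under all of `G`
although the mean is invariant only under `A`. -/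
theorem translate_mul {e f : G} (g : e ⟶ f) (x : EndingIn e) (φ : EndingIn f → ℝ) :
    m.translate (EndingIn.mul g x) φ = m.translate x (φ ∘ EndingIn.mul g) := by
  rw [translate_apply, translate_apply]
  change m.mean x.1 _ = _
  congr 1
  funext h
  exact congrArg φ (EndingIn.mul_mul x.2 g h).symm

/-- Invariance under the morphism `x` of `A` removes the dependence on `x`. -/
theorem translate_map {a : A} (x : EndingIn a) {φ : EndingIn (i.obj a) → ℝ} {K : ℝ}
    (hφ : ∀ h, |φ h| ≤ K) : m.translate (EndingIn.map i x) φ = m.mean (i.obj a) φ :=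
  m.mean_mul x.2 φ K hφ

/-- The alternating average of a cochain. -/
def altAverage (e : G) (n : ℕ) :
    TupleCochain (EndingIn e) n →ₗ[ℝ] TupleCochain (EndingIn e) n :=
  TupleCochain.alternate n ∘ₗ TupleCochain.average m.translate n

theorem altAverage_zero (e : G) (f : TupleCochain (EndingIn e) 0) : m.altAverage e 0 f = f := rfl

theorem altAverage_δ (e : G) (n : ℕ) (f : TupleCochain (EndingIn e) n) :
    m.altAverage e (n + 1) (TupleCochain.δ n f) = TupleCochain.δ n (m.altAverage e n f) := by
  simp only [altAverage, LinearMap.comp_apply]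
  rw [TupleCochain.average_δ m.translate_const, TupleCochain.alternate_δ]

theorem abs_altAverage_le (e : G) (n : ℕ) (f : TupleCochain (EndingIn e) n) (K : ℝ)
    (hf : ∀ x, |f x| ≤ K) (x : Fin n → EndingIn e) : |m.altAverage e n f x| ≤ K :=
  TupleCochain.abs_alternate_le (TupleCochain.abs_average_le m.abs_translate_le hf) x

theorem altAverage_pull {e f : G} (g : e ⟶ f) (n : ℕ) (φ : TupleCochain (EndingIn f) n) :
    m.altAverage e n (TupleCochain.pull (EndingIn.mul g) φ) =
      TupleCochain.pull (EndingIn.mul g) (m.altAverage f n φ) := by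
  simp only [altAverage, LinearMap.comp_apply]
  rw [TupleCochain.average_pull (m.translate_mul g), TupleCochain.alternate_pull]

/-- All entries from `A` define the same mean, so the average is constant there and its alternation
vanishes. -/
theorem altAverage_map {a : A} {n : ℕ} {f : TupleCochain (EndingIn (i.obj a)) (n + 2)} {K : ℝ}
    (hf : ∀ x, |f x| ≤ K) (x : Fin (n + 2) → EndingIn a) :
    m.altAverage (i.obj a) (n + 2) f (EndingIn.map i ∘ x) = 0 := by
  refine TupleCochain.alternate_eq_zero_of_const (S := Set.range (EndingIn.map i))
    -- The constant is read off at the tuple all of whose entries are the identity of `a`.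
    (c := TupleCochain.average m.translate (n + 2) f fun _ => EndingIn.map i ⟨a, 𝟙 a⟩)
    (fun y hy => ?_) _ fun k => ⟨_, rfl⟩
  refine TupleCochain.average_congr m.abs_translate_le hf _ _ fun k φ hφ => ?_
  obtain ⟨z, hz⟩ := hy k
  rw [← hz, m.translate_map _ hφ, m.translate_map _ hφ]

variable {V : NormedMod.{v, u, w} G}

/-- Every bounded cocycle of positive degree is cohomologous to a relative one whose norm is not
larger. -/
theorem exists_mem_relCochain_of_d_eq_zero (m : RelativeMean i) {n : ℕ}
    (φ : BddCochain (dualMod V) (n + 1))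
    (hφ : bddDifferentialₗ (dualMod V) (n + 1) φ = 0) :
    ∃ ψ : BddCochain (dualMod V) (n + 1), ψ ∈ relCochain i (dualMod V) (n + 1) ∧ ‖ψ‖ ≤ ‖φ‖ ∧
      ∃ χ : BddCochain (dualMod V) n, bddDifferentialₗ (dualMod V) n χ = ψ - φ := by
  let ψ : BddCochain (dualMod V) (n + 1) :=
    BddCochain.ofEval (fun e => m.altAverage e (n + 2) ∘ₗ φ.eval e) ‖φ‖ (norm_nonneg _)
      (fun e y => m.abs_altAverage_le e _ _ _ (φ.abs_eval_le e y)) fun {e f} g y => by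
        rw [LinearMap.comp_apply, ← altAverage_pull, φ.eval_act]
        rfl
  let χ : BddCochain (dualMod V) n :=
    BddCochain.ofEval (fun e => TupleCochain.homotopy (m.altAverage e) (n + 1) ∘ₗ φ.eval e)
      (TupleCochain.homotopyBound (n + 1) * ‖φ‖)
      (mul_nonneg (TupleCochain.homotopyBound_nonneg _) (norm_nonneg _))
      (fun e y x => by
        rw [mul_assoc]
        exact TupleCochain.abs_homotopy_le (m.abs_altAverage_le e) _ _ _ (φ.abs_eval_le e y) x) fun {e f} g y => by
        rw [LinearMap.comp_apply, ← TupleCochain.homotopy_pull (m.altAverage_pull g), φ.eval_act]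
        rfl
  refine ⟨ψ, BddCochain.mem_relCochain_iff.2 fun a y x => ?_, BddCochain.norm_ofEval_le, χ,
    BddCochain.ext_eval fun e y => ?_⟩
  · rw [BddCochain.eval_ofEval]
    exact m.altAverage_map (φ.abs_eval_le _ y) x
  · have h : TupleCochain.δ (n + 2) (φ.eval e y) = 0 := by
      rw [← BddCochain.eval_d, hφ]
      rfl
    rw [BddCochain.eval_d, BddCochain.eval_sub, BddCochain.eval_ofEval, BddCochain.eval_ofEval]
    exact TupleCochain.δ_homotopy (m.altAverage_zero e) (m.altAverage_δ e) h

/-- The tuples which lie in a translate of `A`. -/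
def IsTranslate (i : A ⥤ G) {n : ℕ} {e : G} (x : Fin n → EndingIn e) : Prop :=
  ∃ (a : A) (p : i.obj a ⟶ e) (y : Fin n → EndingIn a),
    x = EndingIn.mul p ∘ EndingIn.map i ∘ y

theorem IsTranslate.mul {n : ℕ} {e f : G} (g : e ⟶ f) {x : Fin n → EndingIn e}
    (hx : IsTranslate i x) : IsTranslate i (EndingIn.mul g ∘ x) := by
  obtain ⟨a, p, y, rfl⟩ := hx
  exact ⟨a, p ≫ g, y, EndingIn.mul_comp_mul _ _ _⟩

theorem isTranslate_mul_iff {n : ℕ} {e f : G} (g : e ⟶ f) {x : Fin n → EndingIn e} :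
    IsTranslate i (EndingIn.mul g ∘ x) ↔ IsTranslate i x := by
  refine ⟨fun h => ?_, IsTranslate.mul g⟩
  have := h.mul (Groupoid.inv g)
  rwa [EndingIn.mul_comp_mul, Groupoid.comp_inv, EndingIn.id_mul_comp] at this

theorem isTranslate_map {n : ℕ} {a : A} (y : Fin n → EndingIn a) :
    IsTranslate i (EndingIn.map i ∘ y) :=
  ⟨a, 𝟙 _, y, (EndingIn.id_mul_comp _).symm⟩

open Classical in
/-- The contraction of a cochain along the translates of `A`, extended by zero. -/
def contract (e : G) (n : ℕ) :
    TupleCochain (EndingIn e) (n + 2) →ₗ[ℝ] TupleCochain (EndingIn e) (n + 1) where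
  -- The new entry is averaged in the coset determined by `x 0`. Being a translate is invariant
  -- under left multiplication, so the cutoff preserves equivariance.
  toFun f x := if IsTranslate i x then m.translate (x 0) fun z => f (Fin.cons z x) else 0
  map_add' f g := by
    funext x
    by_cases hx : IsTranslate i x
    · simp only [hx, if_true, Pi.add_apply]
      exact map_add (m.translate (x 0)) _ _
    · simp [hx]
  map_smul' r f := by
    funext x
    by_cases hx : IsTranslate i x
    · simp only [hx, if_true, Pi.smul_apply]
      exact map_smul (m.translate (x 0)) r _
    · simp [hx]

open Classical in
theorem contract_apply (e : G) (n : ℕ) (f : TupleCochain (EndingIn e) (n + 2))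
    (x : Fin (n + 1) → EndingIn e) : m.contract e n f x =
      if IsTranslate i x then m.translate (x 0) fun z => f (Fin.cons z x) else 0 := rfl

theorem abs_contract_le (e : G) (n : ℕ) {f : TupleCochain (EndingIn e) (n + 2)} {K : ℝ}
    (hf : ∀ x, |f x| ≤ K) (x : Fin (n + 1) → EndingIn e) : |m.contract e n f x| ≤ K := by
  rw [contract_apply]
  split_ifs
  · exact m.abs_translate_le _ _ _ fun _ => hf _
  · rw [abs_zero]
    exact (abs_nonneg _).trans (hf fun _ => x 0)

theorem contract_pull {e f : G} (g : e ⟶ f) (n : ℕ) (φ : TupleCochain (EndingIn f) (n + 2)) :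
    m.contract e n (TupleCochain.pull (EndingIn.mul g) φ) =
      TupleCochain.pull (EndingIn.mul g) (m.contract f n φ) := by
  funext x
  rw [TupleCochain.pull_apply, contract_apply, contract_apply, Function.comp_apply,
    m.translate_mul]
  simp only [TupleCochain.pull_apply, Fin.comp_cons]
  classical exact if_congr (isTranslate_mul_iff g).symm rfl rfl

/-- The mean no longer depends on `x 0`, so it can be exchanged with deletions, including that of
the first entry. -/
theorem contract_map {a : A} {n : ℕ} {f : TupleCochain (EndingIn (i.obj a)) (n + 2)} {K : ℝ}
    (hf : ∀ x, |f x| ≤ K) (x : Fin (n + 1) → EndingIn a) :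
    m.contract (i.obj a) n f (EndingIn.map i ∘ x) =
      m.mean (i.obj a) fun z => f (Fin.cons z (EndingIn.map i ∘ x)) := by
  rw [contract_apply, if_pos (isTranslate_map x)]
  exact m.translate_map _ fun _ => hf _

/-- On tuples of `A`, a cochain whose coboundary vanishes on `A` is the coboundary of its
contraction. -/
theorem δ_contract_map {a : A} {n : ℕ} {f : TupleCochain (EndingIn (i.obj a)) (n + 2)} {K : ℝ}
    (hf : ∀ x, |f x| ≤ K)
    (h : ∀ x : Fin (n + 3) → EndingIn a, TupleCochain.δ (n + 2) f (EndingIn.map i ∘ x) = 0)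
    (x : Fin (n + 2) → EndingIn a) :
    TupleCochain.δ (n + 1) (m.contract (i.obj a) n f) (EndingIn.map i ∘ x) =
      f (EndingIn.map i ∘ x) := by
  have h₁ : TupleCochain.δ (n + 1) (m.contract (i.obj a) n f) (EndingIn.map i ∘ x) =
      m.mean (i.obj a) fun z => TupleCochain.δ (n + 1) (TupleCochain.slice z f)
        (EndingIn.map i ∘ x) := by
    have h₂ : (fun z => TupleCochain.δ (n + 1) (TupleCochain.slice z f) (EndingIn.map i ∘ x)) =
        ∑ j : Fin (n + 2), (-1 : ℝ) ^ (j : ℕ) •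
          fun z => f (Fin.cons z (EndingIn.map i ∘ j.removeNth x)) := by
      funext z
      simp only [TupleCochain.δ_apply, Finset.sum_apply]
      rfl
    rw [h₂, map_sum, TupleCochain.δ_apply]
    refine Finset.sum_congr rfl fun j _ => ?_
    rw [map_smul, smul_eq_mul, ← m.contract_map hf]
    rfl
  -- With the target value written as the mean of a constant, the two integrands need only agree at
  -- morphisms `y` of `A`. There `slice_δ` and the vanishing of `δ f` on `A` give equality.
  rw [h₁, ← m.mean_const (i.obj a) (f (EndingIn.map i ∘ x))]
  refine m.mean_congr a _ _ fun y => ?_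
  have h₃ := congrFun (TupleCochain.slice_δ (EndingIn.map i y) f) (EndingIn.map i ∘ x)
  rw [TupleCochain.slice_apply, ← Fin.comp_cons, h] at h₃
  exact (sub_eq_zero.1 h₃.symm).symm

/-- If the coboundary of a bounded cochain of positive degree is relative, then it is the
coboundary of a relative cochain. -/
theorem exists_mem_relCochain_of_d_mem (m : RelativeMean i) {n : ℕ}
    (φ : BddCochain (dualMod V) (n + 1))
    (hφ : bddDifferentialₗ (dualMod V) (n + 1) φ ∈ relCochain i (dualMod V) (n + 2)) :
    ∃ ψ : BddCochain (dualMod V) (n + 1), ψ ∈ relCochain i (dualMod V) (n + 1) ∧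
      bddDifferentialₗ (dualMod V) (n + 1) ψ = bddDifferentialₗ (dualMod V) (n + 1) φ := by
  let χ : BddCochain (dualMod V) n :=
    BddCochain.ofEval (fun e => m.contract e n ∘ₗ φ.eval e) ‖φ‖ (norm_nonneg _)
      (fun e y => m.abs_contract_le e n (φ.abs_eval_le e y)) fun {e f} g y => by
        rw [LinearMap.comp_apply, ← contract_pull, φ.eval_act]
        rfl
  -- Subtracting `dχ` cancels `φ` on `A` and leaves its coboundary unchanged.
  refine ⟨φ - bddDifferentialₗ (dualMod V) n χ,
    BddCochain.mem_relCochain_iff.2 fun a y x => ?_, ?_⟩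
  · rw [BddCochain.eval_sub, BddCochain.eval_d, BddCochain.eval_ofEval, Pi.sub_apply, sub_eq_zero]
    refine (m.δ_contract_map (φ.abs_eval_le _ y) (fun z => ?_) x).symm
    rw [← BddCochain.eval_d]
    exact BddCochain.mem_relCochain_iff.1 hφ a y z
  · rw [map_sub]
    exact (congrArg _ ((bddComplex (dualMod V)).d_comp_d n χ)).trans (sub_zero _)

end RelativeMean

end Mean

end BoundedCohomology
end

namespace BoundedCohomology

/-! ### Isometric isomorphisms induced by inclusions of subcomplexes -/

namespace NormedCochainComplex

variable {C : NormedCochainComplex.{w}} {S : ∀ n, Submodule ℝ (C.X n)}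
  {hS : ∀ n, ∀ x ∈ S n, C.d n x ∈ S (n + 1)} {n : ℕ}

theorem norm_mk_le (x : C.cocycles n) : ‖(Submodule.Quotient.mk x : C.Cohomology n)‖ ≤ ‖x.1‖ :=
  Submodule.Quotient.norm_mk_le _ x

theorem exists_norm_lt (x : C.Cohomology n) {ε : ℝ} (hε : 0 < ε) :
    ∃ y : C.cocycles n, Submodule.Quotient.mk y = x ∧ ‖y.1‖ < ‖x‖ + ε :=
  Submodule.Quotient.norm_mk_lt x hε

theorem cohomologyMap_subInclusion_mk (x : (C.sub S hS).cocycles n) :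
    (C.subInclusion S hS).cohomologyMap n (Submodule.Quotient.mk x) =
      Submodule.Quotient.mk ⟨x.1.1, congrArg Subtype.val x.2⟩ := rfl

theorem norm_cohomologyMap_subInclusion_le (x : (C.sub S hS).Cohomology n) :
    ‖(C.subInclusion S hS).cohomologyMap n x‖ ≤ ‖x‖ := by
  refine le_of_forall_pos_le_add fun ε hε => ?_
  obtain ⟨y, rfl, hy⟩ := exists_norm_lt x hε
  rw [cohomologyMap_subInclusion_mk]
  exact (norm_mk_le _).trans hy.le

/-- A relative cocycle that bounds in `C` has, by `h`, a primitive already in the subcomplex. -/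
theorem cohomologyMap_subInclusion_injective
    (h : ∀ y : C.X n, C.d n y ∈ S (n + 1) → ∃ y' ∈ S n, C.d n y' = C.d n y) :
    Function.Injective ((C.subInclusion S hS).cohomologyMap (n + 1)) := by
  refine (injective_iff_map_eq_zero _).2 fun x => ?_
  obtain ⟨x, rfl⟩ := Submodule.Quotient.mk_surjective _ x
  intro hx
  rw [cohomologyMap_subInclusion_mk, Submodule.Quotient.mk_eq_zero] at hx
  obtain ⟨y, hy⟩ := hx
  have hy' : C.d n y = x.1.1 := hy
  obtain ⟨y', hS', hyy'⟩ := h y (by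
    rw [hy']
    exact x.1.2)
  rw [Submodule.Quotient.mk_eq_zero]
  exact ⟨⟨y', hS'⟩, Subtype.ext (hyy'.trans hy')⟩

/-- If cocycles have representatives of no larger norm in a subcomplex, so have their cohomology
classes. -/
theorem exists_cohomologyMap_subInclusion_eq
    (h : ∀ x : C.X (n + 1), C.d (n + 1) x = 0 →
      ∃ x' ∈ S (n + 1), ‖x'‖ ≤ ‖x‖ ∧ ∃ y, C.d n y = x' - x)
    (x : C.cocycles (n + 1)) : ∃ x' : (C.sub S hS).Cohomology (n + 1), ‖x'‖ ≤ ‖x.1‖ ∧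
      (C.subInclusion S hS).cohomologyMap (n + 1) x' = Submodule.Quotient.mk x := by
  obtain ⟨x', hx', hle, y, hy⟩ := h x.1 x.2
  have hd : C.d (n + 1) x' = 0 := by
    have h' := C.d_comp_d n y
    rw [hy, map_sub] at h'
    exact (sub_eq_zero.1 h').trans x.2
  let z : (C.sub S hS).cocycles (n + 1) := ⟨⟨x', hx'⟩, Subtype.ext hd⟩
  refine ⟨Submodule.Quotient.mk z, (norm_mk_le z).trans hle, ?_⟩
  rw [cohomologyMap_subInclusion_mk, Submodule.Quotient.eq]
  exact ⟨y, hy⟩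

/-- The inclusion cannot increase the seminorm. Conversely, a nearly optimal representative of the
image class is replaced through `h₂` by one in the subcomplex; injectivity from `h₁` identifies its
class with the original one. -/
theorem bijective_and_norm_cohomologyMap_subInclusion
    (h₁ : ∀ y : C.X n, C.d n y ∈ S (n + 1) → ∃ y' ∈ S n, C.d n y' = C.d n y)
    (h₂ : ∀ x : C.X (n + 1), C.d (n + 1) x = 0 →
      ∃ x' ∈ S (n + 1), ‖x'‖ ≤ ‖x‖ ∧ ∃ y, C.d n y = x' - x) :
    Function.Bijective ((C.subInclusion S hS).cohomologyMap (n + 1)) ∧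
      ∀ x, ‖(C.subInclusion S hS).cohomologyMap (n + 1) x‖ = ‖x‖ := by
  have hinj := cohomologyMap_subInclusion_injective (hS := hS) h₁
  refine ⟨⟨hinj, fun x => ?_⟩, fun x => le_antisymm (norm_cohomologyMap_subInclusion_le x) ?_⟩
  · obtain ⟨x, rfl⟩ := Submodule.Quotient.mk_surjective _ x
    obtain ⟨x', -, hx'⟩ := exists_cohomologyMap_subInclusion_eq (hS := hS) h₂ x
    exact ⟨x', hx'⟩
  · refine le_of_forall_pos_le_add fun ε hε => ?_
    obtain ⟨y, hy, hyε⟩ := exists_norm_lt ((C.subInclusion S hS).cohomologyMap (n + 1) x) hε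
    obtain ⟨x', hle, hx'⟩ := exists_cohomologyMap_subInclusion_eq (hS := hS) h₂ y
    rw [← hinj (hx'.trans hy)]
    rw [← hinj (hx'.trans hy)] at hyε
    exact hle.trans hyε.le

end NormedCochainComplex

theorem HbRel.bijective_and_norm_toHb {G : Type u} [Groupoid.{v} G] {A : Type u'}
    [Groupoid.{v'} A] {i : A ⥤ G} {W : NormedMod.{v, u, w} G} {n : ℕ}
    (h₁ : ∀ φ : BddCochain W n, bddDifferentialₗ W n φ ∈ relCochain i W (n + 1) →
      ∃ ψ : BddCochain W n, ψ ∈ relCochain i W n ∧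
        bddDifferentialₗ W n ψ = bddDifferentialₗ W n φ)
    (h₂ : ∀ φ : BddCochain W (n + 1), bddDifferentialₗ W (n + 1) φ = 0 →
      ∃ ψ : BddCochain W (n + 1), ψ ∈ relCochain i W (n + 1) ∧ ‖ψ‖ ≤ ‖φ‖ ∧
        ∃ χ : BddCochain W n, bddDifferentialₗ W n χ = ψ - φ) :
    Function.Bijective (HbRel.toHb i W (n + 1)) ∧
      ∀ x : HbRel i W (n + 1), ‖HbRel.toHb i W (n + 1) x‖ = ‖x‖ :=
  NormedCochainComplex.bijective_and_norm_cohomologyMap_subInclusion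
    (hS := relCochain_d i W) h₁ h₂

end BoundedCohomology

theorem corollary6p5 {G : Type u} [CategoryTheory.Groupoid.{v} G]
    {A : Type u'} [CategoryTheory.Groupoid.{v'} A]
    (i : A ⥤ G) (hi : BoundedCohomology.IsPair i) (hA : BoundedCohomology.IsAmenable A)
    (V : BoundedCohomology.NormedMod.{v, u, w} G) [V.IsBanach]
    (n : ℕ) (hn : 2 ≤ n) :
    Function.Bijective (BoundedCohomology.HbRel.toHb i (BoundedCohomology.dualMod V) n) ∧
      ∀ x : BoundedCohomology.HbRel i (BoundedCohomology.dualMod V) n,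
        ‖BoundedCohomology.HbRel.toHb i (BoundedCohomology.dualMod V) n x‖ = ‖x‖ := by
  -- One successor is the degree shift between a primitive and its coboundary; the other makes the
  -- degree of the primitive positive, as the contraction requires.
  obtain ⟨k, rfl⟩ : ∃ k, n = k + 1 + 1 := Nat.exists_eq_add_of_le' hn
  obtain ⟨m⟩ := hA.nonempty_relativeMean hi.obj_injective
  exact BoundedCohomology.HbRel.bijective_and_norm_toHb
    (fun φ hφ => m.exists_mem_relCochain_of_d_mem φ hφ)
    (fun φ hφ => m.exists_mem_relCochain_of_d_eq_zero φ hφ)
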